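/- Fix an integer $p\ge 2$ and a function $f:\mathbb R\to[0,\infty)$ that is monotone increasing and twice differentiable at $0$, with $f(0)=f'(0)=1$. For $\theta\in\mathcal S^{p-1}:=\{x\in\mathbb R^p:\|x\|=1\}$ and $\kappa\in\mathbb R$, let $P_{\theta,\kappa,f}$ be the distribution on $\mathcal S^{p-1}$ with density $$x\mapsto \frac{c_{p,\kappa,f}\,\Gamma(\frac{p-1}{2})}{2\pi^{(p-1)/2}}\, f\big(\kappa (x'\theta)^2\big),\qquad c_{p,\kappa,f}=1\Big/\int_{-1}^1(1-s^2)^{(p-3)/2}f(\kappa s^2)\,ds,$$ with respect to the surface area measure. Let $X_{n1},\dots,X_{nn}$ ($n\ge 1$) be a triangular array of random vectors with values in $\mathcal S^{p-1}$, put $\mathbf S_n=n^{-1}\sum_{i=1}^n X_{ni}X_{ni}'$, and let $\hat\lambda_{n1}$ and $\hat\lambda_{np}$ be the largest and smallest eigenvalues of $\mathbf S_n$. Let $\mathbf I_{p}$ and $\mathbf I_{p^2}$ be identity matrices, $\mathbf K_p=\sum_{i,j=1}^p(e_ie_j')\otimes(e_je_i')$ the commutation matrix (with $e_1,\dots,e_p$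 the canonical basis of $\mathbb R^p$), $\mathbf J_p=(\mathrm{vec}\,\mathbf I_p)(\mathrm{vec}\,\mathbf I_p)'$, where $\mathrm{vec}$ stacks the columns of a matrix, and let $\mathbf Z$ be a $p\times p$ random matrix with $\mathrm{vec}\,\mathbf Z\sim\mathcal N(\mathbf 0,\mathbf V_p)$, where $$\mathbf V_p=\frac{p}{p+2}(\mathbf I_{p^2}+\mathbf K_p)-\frac{2}{p+2}\mathbf J_p$$ (so that $\mathbf Z$ is symmetric almost surely). Then the following hold as $n\to\infty$. (i) If, for each $n$, $X_{n1},\dots,X_{nn}$ are independent and uniformly distributed over $\mathcal S^{p-1}$, then $$\big(\sqrt n(p\hat\lambda_{n1}-1),\ \sqrt n(p\hat\lambda_{np}-1)\big)\stackrel{\mathcal D}{\to}\big(L_p^{\max},L_p^{\min}\big),$$ where $L_p^{\max}$ and $L_p^{\min}$ are the largest and smallest eigenvalues of $\mathbf Z$. (ii) Let $\theta\in\mathcal S^{p-1}$ and $\kappa_n=\tau_n p/\sqrt n$, where $(\tau_n)$ is a real sequence with $\tau_n\to\tau\in\mathbb R$. If, for each $n$, $X_{n1},\dots,X_{nn}$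 are independent with common distribution $P_{\theta,\kappa_n,f}$, then $$\big(\sqrt n(p\hat\lambda_{n1}-1),\ \sqrt n(p\hat\lambda_{np}-1)\big)\stackrel{\mathcal D}{\to}\big(L_{p,\tau}^{\max},L_{p,\tau}^{\min}\big),$$ where $L_{p,\tau}^{\max}$ and $L_{p,\tau}^{\min}$ are the largest and smallest eigenvalues of $\mathbf Z+\frac{2\tau}{p+2}\mathbf W_\tau$, with $\mathbf W_\tau=\mathrm{diag}(p-1,-1,\dots,-1)$ if $\tau\ge 0$ and $\mathbf W_\tau=\mathrm{diag}(-1,\dots,-1,p-1)$ if $\tau<0$. -/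

import Mathlib

open MeasureTheory ProbabilityTheory Filter Topology Matrix
open scoped Kronecker

namespace AxialUniformity

/-- The unit sphere `S^{p-1}` of `ℝ^p`. -/
abbrev Sph (p : ℕ) : Type := Metric.sphere (0 : EuclideanSpace ℝ (Fin p)) 1

/-- The surface area measure of `S^{p-1}`. -/
noncomputable def surfaceMeasure (p : ℕ) : Measure (Sph p) :=
  (volume : Measure (EuclideanSpace ℝ (Fin p))).toSphere

/-- The uniform distribution over `S^{p-1}`. -/
noncomputable def uniformLaw (p : ℕ) : Measure (Sph p) :=
  (surfaceMeasure p Set.univ)⁻¹ • surfaceMeasure p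

/-- The class of functions `f : ℝ → [0, ∞)` that are monotone increasing and twice differentiable
at `0`, with `f 0 = f' 0 = 1`. -/
structure IsAngular (f : ℝ → ℝ) : Prop where
  nonneg : ∀ x, 0 ≤ f x
  mono : Monotone f
  differentiable_near : ∀ᶠ x in 𝓝 (0 : ℝ), DifferentiableAt ℝ f x
  differentiable_deriv : DifferentiableAt ℝ (deriv f) 0
  map_zero : f 0 = 1
  deriv_zero : deriv f 0 = 1

/-- The constant `c_{p,κ,f} = 1 / ∫_{-1}^1 (1 - s²)^{(p-3)/2} f(κ s²) ds`. -/
noncomputable def normConst (p : ℕ) (κ : ℝ) (f : ℝ → ℝ) : ℝ :=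
  1 / ∫ s in (-1 : ℝ)..1, (1 - s ^ 2) ^ (((p : ℝ) - 3) / 2) * f (κ * s ^ 2)

/-- The axial density
`x ↦ c_{p,κ,f} Γ((p-1)/2) / (2 π^{(p-1)/2}) f(κ (x'θ)²)` with respect to surface area. -/
noncomputable def axialDensity (p : ℕ) (θ : Sph p) (κ : ℝ) (f : ℝ → ℝ) (x : Sph p) : ℝ :=
  normConst p κ f * Real.Gamma (((p : ℝ) - 1) / 2) / (2 * Real.pi ^ (((p : ℝ) - 1) / 2)) *
    f (κ * (inner ℝ (x : EuclideanSpace ℝ (Fin p)) (θ : EuclideanSpace ℝ (Fin p))) ^ 2)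

/-- The axial distribution with location `θ`, concentration `κ` and angular function `f`. -/
noncomputable def axialLaw (p : ℕ) (θ : Sph p) (κ : ℝ) (f : ℝ → ℝ) : Measure (Sph p) :=
  (surfaceMeasure p).withDensity fun x => ENNReal.ofReal (axialDensity p θ κ f x)

/-- `X_1, …, X_n` is a random sample (mutually independent observations) from the law `ν`. -/
structure IsRandomSample {p n : ℕ} {Ω : Type*} [MeasurableSpace Ω] (X : Fin n → Ω → Sph p)
    (ν : Measure (Sph p)) (P : Measure Ω) : Prop where
  hasLaw : ∀ i, HasLaw (X i) ν P
  indep : iIndepFun X P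

/-- `S_n = n⁻¹ ∑ X_i X_i'`. -/
noncomputable def sampleCov {p n : ℕ} (x : Fin n → Sph p) : Matrix (Fin p) (Fin p) ℝ :=
  (n : ℝ)⁻¹ • ∑ i, vecMulVec ((x i : EuclideanSpace ℝ (Fin p)) : Fin p → ℝ)
    ((x i : EuclideanSpace ℝ (Fin p)) : Fin p → ℝ)

/-- The largest (real) eigenvalue of a matrix; see `isGreatest_maxEigenvalue`. -/
noncomputable def maxEigenvalue {p : ℕ} (A : Matrix (Fin p) (Fin p) ℝ) : ℝ :=
  sSup {l : ℝ | Module.End.HasEigenvalue (Matrix.toLin' A) l}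

/-- The smallest (real) eigenvalue of a matrix; see `isLeast_minEigenvalue`. -/
noncomputable def minEigenvalue {p : ℕ} (A : Matrix (Fin p) (Fin p) ℝ) : ℝ :=
  sInf {l : ℝ | Module.End.HasEigenvalue (Matrix.toLin' A) l}

theorem eigenvalueSet_eq_spectrum {p : ℕ} (A : Matrix (Fin p) (Fin p) ℝ) :
    {l : ℝ | Module.End.HasEigenvalue (Matrix.toLin' A) l} = spectrum ℝ A := by
  ext l
  rw [Set.mem_ofPred_eq, Module.End.hasEigenvalue_iff_mem_spectrum, Matrix.spectrum_toLin']

theorem eigenvalueSet_finite {p : ℕ} (A : Matrix (Fin p) (Fin p) ℝ) :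
    {l : ℝ | Module.End.HasEigenvalue (Matrix.toLin' A) l}.Finite := by
  rw [eigenvalueSet_eq_spectrum]
  exact Matrix.finite_real_spectrum

theorem eigenvalueSet_nonempty {p : ℕ} (hp : 0 < p) {A : Matrix (Fin p) (Fin p) ℝ}
    (hA : A.IsSymm) : {l : ℝ | Module.End.HasEigenvalue (Matrix.toLin' A) l}.Nonempty := by
  have hH : A.IsHermitian := by
    rw [Matrix.IsHermitian, Matrix.conjTranspose_eq_transpose_of_trivial]
    exact hA
  rw [eigenvalueSet_eq_spectrum, hH.spectrum_real_eq_range_eigenvalues]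
  exact ⟨_, ⟨⟨0, hp⟩, rfl⟩⟩

/-- For symmetric matrices, `maxEigenvalue` is indeed the largest eigenvalue. -/
theorem isGreatest_maxEigenvalue {p : ℕ} (hp : 0 < p) {A : Matrix (Fin p) (Fin p) ℝ}
    (hA : A.IsSymm) :
    IsGreatest {l : ℝ | Module.End.HasEigenvalue (Matrix.toLin' A) l} (maxEigenvalue A) :=
  ⟨(eigenvalueSet_nonempty hp hA).csSup_mem (eigenvalueSet_finite A),
    fun _ hl => le_csSup (eigenvalueSet_finite A).bddAbove hl⟩

/-- For symmetric matrices, `minEigenvalue` is indeed the smallest eigenvalue. -/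
theorem isLeast_minEigenvalue {p : ℕ} (hp : 0 < p) {A : Matrix (Fin p) (Fin p) ℝ}
    (hA : A.IsSymm) :
    IsLeast {l : ℝ | Module.End.HasEigenvalue (Matrix.toLin' A) l} (minEigenvalue A) :=
  ⟨(eigenvalueSet_nonempty hp hA).csInf_mem (eigenvalueSet_finite A),
    fun _ hl => csInf_le (eigenvalueSet_finite A).bddBelow hl⟩

/-- The pair `(√n (p λ̂_{n1} - 1), √n (p λ̂_{np} - 1))`, with `λ̂_{n1}` and `λ̂_{np}` the largest and
smallest eigenvalues of `S_n`. -/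
noncomputable def extremeStat {p n : ℕ} (x : Fin n → Sph p) : ℝ × ℝ :=
  (√(n : ℝ) * ((p : ℝ) * maxEigenvalue (sampleCov x) - 1),
    √(n : ℝ) * ((p : ℝ) * minEigenvalue (sampleCov x) - 1))

/-- The `p² × p²` commutation matrix `K_p = ∑ (e_i e_j') ⊗ (e_j e_i')`. -/
def commMatrix (p : ℕ) : Matrix (Fin p × Fin p) (Fin p × Fin p) ℝ :=
  ∑ i, ∑ j, (Matrix.single i j (1 : ℝ)) ⊗ₖ (Matrix.single j i (1 : ℝ))

/-- `J_p = (vec I_p)(vec I_p)'`. -/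
def JMatrix (p : ℕ) : Matrix (Fin p × Fin p) (Fin p × Fin p) ℝ :=
  vecMulVec (Matrix.vec (1 : Matrix (Fin p) (Fin p) ℝ)) (Matrix.vec (1 : Matrix (Fin p) (Fin p) ℝ))

/-- `V_p = (p/(p+2)) (I_{p²} + K_p) - (2/(p+2)) J_p`. -/
noncomputable def VMatrix (p : ℕ) : Matrix (Fin p × Fin p) (Fin p × Fin p) ℝ :=
  ((p : ℝ) / ((p : ℝ) + 2)) • (1 + commMatrix p) - (2 / ((p : ℝ) + 2)) • JMatrix p

/-- `vec A`, the columns of `A` stacked on top of each other, as a Euclidean vector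
(coordinate `(j, i)` is entry `i` of column `j`). -/
noncomputable def vecE {p : ℕ} (A : Matrix (Fin p) (Fin p) ℝ) :
    EuclideanSpace ℝ (Fin p × Fin p) :=
  WithLp.toLp 2 (Matrix.vec A)

/-- `W_τ = diag(p-1, -1, …, -1)` if `τ ≥ 0` and `W_τ = diag(-1, …, -1, p-1)` if `τ < 0`. -/
noncomputable def WMatrix (p : ℕ) (τ : ℝ) : Matrix (Fin p) (Fin p) ℝ :=
  Matrix.diagonal fun i =>
    if 0 ≤ τ then (if i.val = 0 then (p : ℝ) - 1 else -1)
    else (if i.val + 1 = p then (p : ℝ) - 1 else -1)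

end AxialUniformity

/-! The statistics are the extreme eigenvalues of `√n (p S_n - I)`, whose vectorization is
`n^{-1/2}` times a sum of i.i.d. bounded scores `vec (p x x' - I)`. By Rayleigh they are the maximum
and minimum of a quadratic form over the sphere (`quadExtremes_vecE`), hence continuous functions of
the coefficients. So a central limit theorem for the score sum and the continuous mapping theorem
suffice.

The limit theorem goes through characteristic functions: for bounded row-wise i.i.d. variables, the
limits of `√n` times the mean and of the second moment determine the limit
(`tendsto_integral_cexp_pow`). Under the uniform law, rotation invariance determines the moments of
orders two and four, so the scores are centred with covariance `V_p` (`dotProduct_VMatrix_mulVec`).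

Relative to the uniform law, the axial density is `f (κ w)`, `w = (x'θ)²`, divided by its mean, and
`f (κ w) = 1 + κ w + o(κ)`. As `κ_n` has order `n^{-1/2}`, second moments keep their limits, while
the mean, times `√n`, tends to `τ p` times the uniform moment of score times `w`, that is `2τ/(p+2)`
times the score at `θ`. The statistics are rotation invariant, so `θ` may be taken to be a basis
vector, at which the score is the vectorization of `W_τ`. -/

namespace AxialUniformity

open scoped Pointwise

/-! ### Rotation invariance of surface measure and of the uniform law -/

section SphereSymmetry

variable {p : ℕ}

/-- The action of a linear isometry of `ℝ^p` on the unit sphere. -/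
noncomputable def rotate (L : EuclideanSpace ℝ (Fin p) ≃ₗᵢ[ℝ] EuclideanSpace ℝ (Fin p)) (x : Sph p) : Sph p :=
  ⟨L x, by simp⟩

variable (L : EuclideanSpace ℝ (Fin p) ≃ₗᵢ[ℝ] EuclideanSpace ℝ (Fin p))

@[simp]
theorem coe_rotate (x : Sph p) : (rotate L x : EuclideanSpace ℝ (Fin p)) = L x := rfl

theorem continuous_rotate : Continuous (rotate L) :=
  (L.continuous.comp continuous_subtype_val).subtype_mk _

theorem rotate_symm_rotate (x : Sph p) : rotate L.symm (rotate L x) = x :=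
  Subtype.ext (by simp)

theorem rotate_rotate_symm (x : Sph p) : rotate L (rotate L.symm x) = x :=
  Subtype.ext (by simp)

/-- The surface measure of a set is a multiple of the Lebesgue volume of the cone over it; an
isometry maps cones to cones and preserves volume. -/
theorem measurePreserving_rotate_surfaceMeasure :
    MeasurePreserving (rotate L) (surfaceMeasure p) (surfaceMeasure p) where
  measurable := (continuous_rotate L).measurable
  map_eq := by
    ext s hs
    rw [Measure.map_apply (continuous_rotate L).measurable hs, surfaceMeasure,
      Measure.toSphere_apply' _ hs,
      Measure.toSphere_apply' _ ((continuous_rotate L).measurable hs)]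
    congr 1
    have hpre : (Set.Ioo (0 : ℝ) 1 • ((↑) '' (rotate L ⁻¹' s)) :
        Set (EuclideanSpace ℝ (Fin p))) = L ⁻¹' (Set.Ioo (0 : ℝ) 1 • ((↑) '' s)) := by
      ext y
      simp only [Set.mem_smul, Set.mem_image, Set.mem_preimage]
      constructor
      · rintro ⟨r, hr, _, ⟨x, hx, rfl⟩, rfl⟩
        exact ⟨r, hr, _, ⟨_, hx, rfl⟩, by simp⟩
      · rintro ⟨r, hr, _, ⟨x, hx, rfl⟩, hy⟩
        refine ⟨r, hr, _, ⟨rotate L.symm x, by rwa [rotate_rotate_symm], rfl⟩, ?_⟩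
        apply L.injective
        simpa using hy
    rw [hpre]
    exact L.measurePreserving.measure_preimage_equiv (f := L.toMeasurableEquiv) _

instance : IsFiniteMeasure (surfaceMeasure p) := by
  unfold surfaceMeasure; infer_instance

theorem surfaceMeasure_univ_ne_zero (hp : 0 < p) : surfaceMeasure p Set.univ ≠ 0 := by
  have : Nonempty (Fin p) := ⟨⟨0, hp⟩⟩
  have h : surfaceMeasure p ≠ 0 := Measure.toSphere_ne_zero _
  simpa using h

theorem isProbabilityMeasure_uniformLaw (hp : 0 < p) : IsProbabilityMeasure (uniformLaw p) :=
  ⟨by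
    rw [uniformLaw, Measure.smul_apply, smul_eq_mul]
    exact ENNReal.inv_mul_cancel (surfaceMeasure_univ_ne_zero hp) (measure_ne_top _ _)⟩

theorem measurePreserving_rotate_uniformLaw :
    MeasurePreserving (rotate L) (uniformLaw p) (uniformLaw p) :=
  (measurePreserving_rotate_surfaceMeasure L).smul_measure _

theorem integral_comp_rotate_uniformLaw (g : Sph p → ℝ) :
    ∫ x, g (rotate L x) ∂uniformLaw p = ∫ x, g x ∂uniformLaw p := by
  let e : Sph p ≃ᵐ Sph p :=
    { toFun := rotate L
      invFun := rotate L.symm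
      left_inv := rotate_symm_rotate L
      right_inv := rotate_rotate_symm L
      measurable_toFun := (continuous_rotate L).measurable
      measurable_invFun := (continuous_rotate L.symm).measurable }
  exact (measurePreserving_rotate_uniformLaw L).integral_comp e.measurableEmbedding g

/-- Two vectors of equal norm are exchanged by some linear isometry. -/
theorem exists_isometry_apply_eq {u v : EuclideanSpace ℝ (Fin p)} (h : ‖u‖ = ‖v‖) :
    ∃ L : EuclideanSpace ℝ (Fin p) ≃ₗᵢ[ℝ] EuclideanSpace ℝ (Fin p), L u = v :=
  ⟨_, Submodule.reflection_sub h⟩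

end SphereSymmetry

/-! ### Second and fourth moments of the uniform law -/

section UniformMoments

variable {p : ℕ}

theorem integrable_of_continuous {ν : Measure (Sph p)} [IsFiniteMeasure ν] {E : Type*}
    [NormedAddCommGroup E] {g : Sph p → E} (hg : Continuous g) : Integrable g ν :=
  hg.integrable_of_hasCompactSupport (HasCompactSupport.of_compactSpace g)

/-- Every `u` is the image under an isometry of `‖u‖ • e` with `e` a fixed unit vector, so
invariance leaves one unknown constant per degree. -/
theorem exists_integral_inner_pow (hp : 0 < p) (k : ℕ) :
    ∃ m : ℝ, ∀ u : EuclideanSpace ℝ (Fin p),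
      ∫ x, (inner ℝ (x : EuclideanSpace ℝ (Fin p)) u) ^ k ∂uniformLaw p = m * ‖u‖ ^ k := by
  let e : EuclideanSpace ℝ (Fin p) := EuclideanSpace.single ⟨0, hp⟩ 1
  refine ⟨∫ x, (inner ℝ (x : EuclideanSpace ℝ (Fin p)) e) ^ k ∂uniformLaw p, fun u => ?_⟩
  obtain ⟨L, hL⟩ := exists_isometry_apply_eq (u := ‖u‖ • e) (v := u) (by simp [e, norm_smul])
  rw [← integral_comp_rotate_uniformLaw L, ← integral_mul_const]
  refine integral_congr_ae (.of_forall fun x => ?_)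
  nth_rewrite 1 [← hL]
  simp only [coe_rotate, LinearIsometryEquiv.inner_map_map, inner_smul_right]
  ring

theorem integrable_comp_coe {ν : Measure (Sph p)} [IsFiniteMeasure ν]
    (g : EuclideanSpace ℝ (Fin p) → ℝ) (hg : Continuous g) :
    Integrable (fun x : Sph p => g x) ν :=
  integrable_of_continuous (hg.comp continuous_subtype_val)

/-- Polarization reduces to squares, and summing over an orthonormal basis, where `‖x‖ = 1`, gives
`p m = 1`. -/
theorem integral_inner_mul_inner (hp : 0 < p) (a b : EuclideanSpace ℝ (Fin p)) :
    ∫ x, inner ℝ (x : EuclideanSpace ℝ (Fin p)) a * inner ℝ (x : EuclideanSpace ℝ (Fin p)) b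
      ∂uniformLaw p = inner ℝ a b / p := by
  have := isProbabilityMeasure_uniformLaw hp
  obtain ⟨m, hm⟩ := exists_integral_inner_pow hp 2
  have key : ∀ a b : EuclideanSpace ℝ (Fin p),
      ∫ x, inner ℝ (x : EuclideanSpace ℝ (Fin p)) a * inner ℝ (x : EuclideanSpace ℝ (Fin p)) b
      ∂uniformLaw p = m * inner ℝ a b := by
    intro a b
    have h : ∀ x : Sph p,
        inner ℝ (x : EuclideanSpace ℝ (Fin p)) a * inner ℝ (x : EuclideanSpace ℝ (Fin p)) b =
        ((inner ℝ (x : EuclideanSpace ℝ (Fin p)) (a + b)) ^ 2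
          - (inner ℝ (x : EuclideanSpace ℝ (Fin p)) (a - b)) ^ 2) / 4 := by
      intro x; rw [inner_add_right, inner_sub_right]; ring
    simp_rw [h]
    rw [integral_div, integral_sub (integrable_comp_coe (fun x => inner ℝ x (a + b) ^ 2)
      (by fun_prop)) (integrable_comp_coe (fun x => inner ℝ x (a - b) ^ 2) (by fun_prop)),
      hm, hm, norm_add_sq_real, norm_sub_sq_real]
    ring
  have hsum : (p : ℝ) * m = 1 := by
    have h1 : ∫ x : Sph p, ∑ i : Fin p,
        inner ℝ (x : EuclideanSpace ℝ (Fin p)) (EuclideanSpace.single i 1) *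
        inner ℝ (x : EuclideanSpace ℝ (Fin p)) (EuclideanSpace.single i 1) ∂uniformLaw p
        = p * m := by
      rw [integral_finsetSum]
      · simp [key]
      · intro i _
        exact integrable_comp_coe (fun x => inner ℝ x (EuclideanSpace.single i 1) *
          inner ℝ x (EuclideanSpace.single i 1)) (by fun_prop)
    rw [← h1]
    have h2 : ∀ x : Sph p, ∑ i : Fin p,
        inner ℝ (x : EuclideanSpace ℝ (Fin p)) (EuclideanSpace.single i 1) *
        inner ℝ (x : EuclideanSpace ℝ (Fin p)) (EuclideanSpace.single i 1) = (1 : ℝ) := by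
      intro x
      have hx := (EuclideanSpace.real_norm_sq_eq (x : EuclideanSpace ℝ (Fin p))).symm
      rw [norm_eq_of_mem_sphere, one_pow] at hx
      simpa [EuclideanSpace.inner_single_right, ← pow_two] using hx
    simp [h2]
  have hp0 : (p : ℝ) ≠ 0 := by positivity
  rw [key]
  field_simp
  linear_combination inner ℝ a b * hsum

theorem integral_inner_mul_four (hp : 0 < p) (a b c d : EuclideanSpace ℝ (Fin p)) :
    ∫ x, inner ℝ (x : EuclideanSpace ℝ (Fin p)) a * inner ℝ (x : EuclideanSpace ℝ (Fin p)) b *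
      (inner ℝ (x : EuclideanSpace ℝ (Fin p)) c * inner ℝ (x : EuclideanSpace ℝ (Fin p)) d)
      ∂uniformLaw p =
    (inner ℝ a b * inner ℝ c d + inner ℝ a c * inner ℝ b d + inner ℝ a d * inner ℝ b c) /
      (p * (p + 2)) := by
  have := isProbabilityMeasure_uniformLaw hp
  obtain ⟨m, hm⟩ := exists_integral_inner_pow hp 4
  have hi : ∀ u : EuclideanSpace ℝ (Fin p), Integrable
      (fun x : Sph p => (inner ℝ (x : EuclideanSpace ℝ (Fin p)) u) ^ 4) (uniformLaw p) :=
    fun u => integrable_comp_coe (fun x => inner ℝ x u ^ 4) (by fun_prop)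
  have hn : ∀ u : EuclideanSpace ℝ (Fin p), ‖u‖ ^ 4 = (inner ℝ u u) ^ 2 := by
    intro u; rw [real_inner_self_eq_norm_sq]; ring
  have key : ∀ a b c d : EuclideanSpace ℝ (Fin p),
      ∫ x, inner ℝ (x : EuclideanSpace ℝ (Fin p)) a * inner ℝ (x : EuclideanSpace ℝ (Fin p)) b *
      (inner ℝ (x : EuclideanSpace ℝ (Fin p)) c * inner ℝ (x : EuclideanSpace ℝ (Fin p)) d)
      ∂uniformLaw p = m / 3 *
      (inner ℝ a b * inner ℝ c d + inner ℝ a c * inner ℝ b d + inner ℝ a d * inner ℝ b c) := by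
    intro a b c d
    -- Polarization of a quartic: the signed sum over the 8 sign choices for `b`, `c`, `d` keeps
    -- only the mixed term, with coefficient `8 · 4! = 192`.
    have h : ∀ x : Sph p,
        inner ℝ (x : EuclideanSpace ℝ (Fin p)) a * inner ℝ (x : EuclideanSpace ℝ (Fin p)) b *
        (inner ℝ (x : EuclideanSpace ℝ (Fin p)) c * inner ℝ (x : EuclideanSpace ℝ (Fin p)) d) =
        ((((inner ℝ (x : EuclideanSpace ℝ (Fin p)) (a + b + c + d)) ^ 4
          - (inner ℝ (x : EuclideanSpace ℝ (Fin p)) (a + b + c - d)) ^ 4)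
          - ((inner ℝ (x : EuclideanSpace ℝ (Fin p)) (a + b - c + d)) ^ 4
          - (inner ℝ (x : EuclideanSpace ℝ (Fin p)) (a + b - c - d)) ^ 4))
          - (((inner ℝ (x : EuclideanSpace ℝ (Fin p)) (a - b + c + d)) ^ 4
          - (inner ℝ (x : EuclideanSpace ℝ (Fin p)) (a - b + c - d)) ^ 4)
          - ((inner ℝ (x : EuclideanSpace ℝ (Fin p)) (a - b - c + d)) ^ 4
          - (inner ℝ (x : EuclideanSpace ℝ (Fin p)) (a - b - c - d)) ^ 4))) / 192 := by
      intro x; simp only [inner_add_right, inner_sub_right]; ring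
    simp_rw [h]
    rw [integral_div, integral_sub (by fun_prop) (by fun_prop),
      integral_sub (by fun_prop) (by fun_prop), integral_sub (by fun_prop) (by fun_prop),
      integral_sub (by fun_prop) (by fun_prop), integral_sub (by fun_prop) (by fun_prop),
      integral_sub (by fun_prop) (by fun_prop), integral_sub (by fun_prop) (by fun_prop)]
    simp only [hm, hn]
    simp only [inner_add_left, inner_add_right, inner_sub_left, inner_sub_right]
    rw [real_inner_comm a b, real_inner_comm a c, real_inner_comm a d, real_inner_comm b c,
      real_inner_comm b d, real_inner_comm c d]
    ring
  -- The constant comes from integrating `‖x‖⁴ = 1`: over basis pairs the three pairings contribute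
  -- `p²`, `p` and `p`.
  have hsum : m / 3 * ((p : ℝ) * (p + 2)) = 1 := by
    have h1 : ∫ x : Sph p, ∑ i : Fin p, ∑ j : Fin p,
        inner ℝ (x : EuclideanSpace ℝ (Fin p)) (EuclideanSpace.single i 1) *
        inner ℝ (x : EuclideanSpace ℝ (Fin p)) (EuclideanSpace.single i 1) *
        (inner ℝ (x : EuclideanSpace ℝ (Fin p)) (EuclideanSpace.single j 1) *
        inner ℝ (x : EuclideanSpace ℝ (Fin p)) (EuclideanSpace.single j 1)) ∂uniformLaw p
        = m / 3 * ((p : ℝ) * (p + 2)) := by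
      have hint : ∀ i j : Fin p, Integrable (fun x : Sph p =>
          inner ℝ (x : EuclideanSpace ℝ (Fin p)) (EuclideanSpace.single i 1) *
          inner ℝ (x : EuclideanSpace ℝ (Fin p)) (EuclideanSpace.single i 1) *
          (inner ℝ (x : EuclideanSpace ℝ (Fin p)) (EuclideanSpace.single j 1) *
          inner ℝ (x : EuclideanSpace ℝ (Fin p)) (EuclideanSpace.single j 1))) (uniformLaw p) :=
        fun i j => integrable_comp_coe (fun x => inner ℝ x (EuclideanSpace.single i 1) *
          inner ℝ x (EuclideanSpace.single i 1) * (inner ℝ x (EuclideanSpace.single j 1) *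
          inner ℝ x (EuclideanSpace.single j 1))) (by fun_prop)
      rw [integral_finsetSum _ fun i _ => integrable_finsetSum _ fun j _ => hint i j]
      simp_rw [integral_finsetSum _ fun j _ => hint _ j, key]
      simp [EuclideanSpace.inner_single_left, PiLp.single_apply, mul_add, Finset.sum_add_distrib]
      ring
    rw [← h1]
    have h2 : ∀ x : Sph p, ∑ i : Fin p, ∑ j : Fin p,
        inner ℝ (x : EuclideanSpace ℝ (Fin p)) (EuclideanSpace.single i 1) *
        inner ℝ (x : EuclideanSpace ℝ (Fin p)) (EuclideanSpace.single i 1) *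
        (inner ℝ (x : EuclideanSpace ℝ (Fin p)) (EuclideanSpace.single j 1) *
        inner ℝ (x : EuclideanSpace ℝ (Fin p)) (EuclideanSpace.single j 1)) = (1 : ℝ) := by
      intro x
      have hx := (EuclideanSpace.real_norm_sq_eq (x : EuclideanSpace ℝ (Fin p))).symm
      rw [norm_eq_of_mem_sphere, one_pow] at hx
      simp only [EuclideanSpace.inner_single_right, one_mul, RCLike.conj_to_real, ← pow_two,
        ← Finset.mul_sum, ← Finset.sum_mul]
      rw [hx, one_pow]
    simp [h2]
  have hp0 : (p : ℝ) * (p + 2) ≠ 0 := by positivity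
  rw [key, eq_div_iff hp0]
  linear_combination (inner ℝ a b * inner ℝ c d + inner ℝ a c * inner ℝ b d +
    inner ℝ a d * inner ℝ b c) * hsum

end UniformMoments

end AxialUniformity
-- Limit theorem for characteristic functions and expansion of the axial law
namespace AxialUniformity

/-- Taylor expansion of `exp (i a)` at order two. -/
theorem norm_cexp_sub_taylor_le {a : ℝ} (ha : |a| ≤ 1) :
    ‖Complex.exp (a * Complex.I) - (1 + a * Complex.I - a ^ 2 / 2)‖ ≤ |a| ^ 3 := by
  have hn : ‖(a * Complex.I : ℂ)‖ = |a| := by simp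
  have h := Complex.exp_bound (x := a * Complex.I) (by rwa [hn]) (n := 3) (by norm_num)
  rw [hn] at h
  have hs : ∑ m ∈ Finset.range 3, (a * Complex.I : ℂ) ^ m / (m.factorial : ℂ) =
      1 + a * Complex.I - a ^ 2 / 2 := by
    simp [Finset.sum_range_succ, mul_pow, Nat.factorial]
    ring
  rw [hs] at h
  refine h.trans ?_
  have h3 : (0 : ℝ) ≤ |a| ^ 3 := by positivity
  norm_num [Nat.factorial]
  linarith

/-- The characteristic function step of the central limit theorem for triangular arrays of
row-wise i.i.d. uniformly bounded variables with means of order `n^{-1/2}`. -/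
theorem tendsto_integral_cexp_pow {S : Type*} [MeasurableSpace S] {ν : ℕ → Measure S}
    (hν : ∀ᶠ n in atTop, IsProbabilityMeasure (ν n)) {Y : S → ℝ} (hY : Measurable Y) {K : ℝ}
    (hK : ∀ x, |Y x| ≤ K) {b v : ℝ}
    (hb : Tendsto (fun n : ℕ => √(n : ℝ) * ∫ x, Y x ∂ν n) atTop (𝓝 b))
    (hv : Tendsto (fun n : ℕ => ∫ x, Y x ^ 2 ∂ν n) atTop (𝓝 v)) :
    Tendsto (fun n : ℕ => (∫ x, Complex.exp (((√(n : ℝ))⁻¹ * Y x : ℝ) * Complex.I) ∂ν n) ^ n)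
      atTop (𝓝 (Complex.exp (b * Complex.I - v / 2))) := by
  have hsq : Tendsto (fun n : ℕ => √(n : ℝ)) atTop atTop :=
    Real.tendsto_sqrt_atTop.comp tendsto_natCast_atTop_atTop
  set F : ℕ → ℂ := fun n => ∫ x, Complex.exp (((√(n : ℝ))⁻¹ * Y x : ℝ) * Complex.I) ∂ν n with hF
  set M : ℕ → ℂ := fun n => ((√(n : ℝ) * ∫ x, Y x ∂ν n : ℝ) : ℂ) * Complex.I -
    ((∫ x, Y x ^ 2 ∂ν n : ℝ) : ℂ) / 2 with hM
  have hMlim : Tendsto M atTop (𝓝 (b * Complex.I - v / 2)) :=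
    (((Complex.continuous_ofReal.tendsto b).comp hb).mul_const _).sub
      (((Complex.continuous_ofReal.tendsto v).comp hv).div_const _)
  -- The Taylor error is at most `(K/√n)³` pointwise once `K ≤ √n`; multiplied by `n` it is still
  -- `K³/√n`.
  have hrem : Tendsto (fun n : ℕ => (n : ℂ) * (F n - 1) - M n) atTop (𝓝 0) := by
    have hdec : Tendsto (fun n : ℕ => K ^ 3 * (√(n : ℝ))⁻¹) atTop (𝓝 0) := by
      simpa using (tendsto_inv_atTop_zero.comp hsq).const_mul (K ^ 3)
    refine squeeze_zero_norm' ?_ hdec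
    filter_upwards [hν, eventually_gt_atTop 0, hsq.eventually_ge_atTop K] with n hn hn0 hnK
    have hs0 : (0 : ℝ) < √(n : ℝ) := Real.sqrt_pos.2 (by exact_mod_cast hn0)
    have hss : √(n : ℝ) * √(n : ℝ) = n := Real.mul_self_sqrt (Nat.cast_nonneg n)
    set r : ℝ := (√(n : ℝ))⁻¹ with hr
    have hr0 : 0 < r := inv_pos.2 hs0
    have hbd : ∀ x, |r * Y x| ≤ r * K := fun x => by
      rw [abs_mul, abs_of_pos hr0]
      exact mul_le_mul_of_nonneg_left (hK x) hr0.le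
    have hbd1 : r * K ≤ 1 := by
      rw [hr, inv_mul_le_iff₀ hs0]; linarith
    have hiY : Integrable Y (ν n) :=
      Integrable.of_bound hY.aestronglyMeasurable K (.of_forall hK)
    have hiY2 : Integrable (fun x => Y x ^ 2) (ν n) := by
      refine Integrable.of_bound (by fun_prop) (K ^ 2) (.of_forall fun x => ?_)
      rw [Real.norm_eq_abs, abs_pow]
      exact pow_le_pow_left₀ (abs_nonneg _) (hK x) 2
    have hie : Integrable (fun x => Complex.exp ((r * Y x : ℝ) * Complex.I)) (ν n) := by
      refine Integrable.of_bound (by fun_prop) 1 (.of_forall fun x => ?_)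
      rw [Complex.norm_exp_ofReal_mul_I]
    have hit : Integrable (fun x => 1 + ((r * Y x : ℝ) : ℂ) * Complex.I -
        ((r * Y x : ℝ) : ℂ) ^ 2 / 2) (ν n) := by
      refine ((integrable_const _).add ((hiY.const_mul r).ofReal.mul_const _)).sub ?_
      have : Integrable (fun x => (((r ^ 2 * Y x ^ 2 : ℝ) : ℂ)) / 2) (ν n) :=
        (hiY2.const_mul _).ofReal.div_const _
      refine this.congr (.of_forall fun x => ?_)
      push_cast; ring
    have hT : ∫ x, (1 + ((r * Y x : ℝ) : ℂ) * Complex.I - ((r * Y x : ℝ) : ℂ) ^ 2 / 2) ∂ν n =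
        1 + (r * ∫ x, Y x ∂ν n : ℝ) * Complex.I -
          ((r ^ 2 * ∫ x, Y x ^ 2 ∂ν n : ℝ) : ℂ) / 2 := by
      have h1 : ∀ x, (1 + ((r * Y x : ℝ) : ℂ) * Complex.I - ((r * Y x : ℝ) : ℂ) ^ 2 / 2) =
          (1 + ((r * Y x : ℝ) : ℂ) * Complex.I) - ((r ^ 2 * Y x ^ 2 : ℝ) : ℂ) / 2 := by
        intro x; push_cast; ring
      simp_rw [h1]
      rw [integral_sub ((integrable_const _).add ((hiY.const_mul r).ofReal.mul_const _))
        ((hiY2.const_mul _).ofReal.div_const _), integral_add (integrable_const _)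
        ((hiY.const_mul r).ofReal.mul_const _), integral_mul_const, integral_div,
        integral_complex_ofReal, integral_complex_ofReal, integral_const_mul, integral_const_mul]
      simp
    have hdiff : (n : ℂ) * (F n - 1) - M n = n * ∫ x, (Complex.exp ((r * Y x : ℝ) * Complex.I) -
        (1 + ((r * Y x : ℝ) : ℂ) * Complex.I - ((r * Y x : ℝ) : ℂ) ^ 2 / 2)) ∂ν n := by
      have hFn : F n = ∫ x, Complex.exp ((r * Y x : ℝ) * Complex.I) ∂ν n := rfl
      rw [integral_sub hie hit, hT, hM, ← hFn]
      have e1 : ((n : ℝ) : ℂ) * (r : ℂ) = (√(n : ℝ) : ℂ) := by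
        rw [← Complex.ofReal_mul, hr, ← div_eq_mul_inv, Real.div_sqrt]
      have e2 : ((n : ℝ) : ℂ) * (r : ℂ) ^ 2 = 1 := by
        rw [pow_two, ← mul_assoc, e1, hr, ← Complex.ofReal_mul, mul_inv_cancel₀ hs0.ne',
          Complex.ofReal_one]
      rw [Complex.ofReal_natCast] at e1 e2
      push_cast
      linear_combination ((∫ x, Y x ∂ν n : ℝ) * Complex.I : ℂ) * e1 -
        ((∫ x, Y x ^ 2 ∂ν n : ℝ) / 2 : ℂ) * e2
    rw [hdiff, norm_mul, Complex.norm_natCast]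
    have hle : ‖∫ x, (Complex.exp ((r * Y x : ℝ) * Complex.I) -
        (1 + ((r * Y x : ℝ) : ℂ) * Complex.I - ((r * Y x : ℝ) : ℂ) ^ 2 / 2)) ∂ν n‖ ≤
        (r * K) ^ 3 := by
      refine (norm_integral_le_of_norm_le_const (C := (r * K) ^ 3)
        (.of_forall fun x => ?_)).trans_eq (by simp)
      exact (norm_cexp_sub_taylor_le ((hbd x).trans hbd1)).trans
        (pow_le_pow_left₀ (abs_nonneg _) (hbd x) 3)
    refine (mul_le_mul_of_nonneg_left hle (Nat.cast_nonneg n)).trans_eq ?_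
    have e3 : (n : ℝ) * r ^ 2 = 1 := by
      rw [hr, inv_pow, pow_two, hss, mul_inv_cancel₀]
      exact_mod_cast hn0.ne'
    linear_combination (K ^ 3 * r) * e3
  have hlim : Tendsto (fun n : ℕ => (n : ℂ) * (F n - 1)) atTop
      (𝓝 (b * Complex.I - v / 2)) := by
    simpa using hrem.add hMlim
  simpa only [add_sub_cancel] using Complex.tendsto_one_add_pow_exp_of_tendsto hlim

/-- First-order expansion of `∫ φ f(κ_n w)` as `κ_n → 0`. -/
theorem exists_integral_mul_comp_expansion {S : Type*} [MeasurableSpace S] {μ : Measure S}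
    [IsProbabilityMeasure μ] {w φ : S → ℝ} (hw : Measurable w) (hφ : Measurable φ) {K : ℝ}
    (hw1 : ∀ x, |w x| ≤ 1) (hK : ∀ x, |φ x| ≤ K) {f : ℝ → ℝ} (hfm : Measurable f)
    (hf : HasDerivAt f 1 0) (hf0 : f 0 = 1) {κ : ℕ → ℝ} (hκ : Tendsto κ atTop (𝓝 0)) :
    ∃ h : ℕ → ℝ, Tendsto h atTop (𝓝 (∫ x, φ x * w x ∂μ)) ∧
      ∀ᶠ n in atTop, ∫ x, φ x * f (κ n * w x) ∂μ = ∫ x, φ x ∂μ + κ n * h n := by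
  -- With this slope, `f x = 1 + x g x` exactly, and `g` is continuous at `0` with value `1`;
  -- differentiability at the single point `0` is enough.
  set g : ℝ → ℝ := dslope f 0 with hg
  have hg0 : g 0 = 1 := by rw [hg, dslope_same, hf.deriv]
  have hgc : Tendsto g (𝓝 0) (𝓝 1) := by
    have := (continuousAt_dslope_same.2 hf.differentiableAt).tendsto
    rwa [← hg, hg0] at this
  have hgm : Measurable g := by
    have : g = fun x => if x = 0 then 1 else (f x - 1) / x := by
      ext x
      split_ifs with hx
      · rw [hx, hg0]
      · rw [hg, dslope_of_ne f hx, slope_def_field, hf0, sub_zero]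
    rw [this]
    exact Measurable.ite (measurableSet_singleton 0) measurable_const
      ((hfm.sub_const 1).div measurable_id)
  have hfg : ∀ x, f x = 1 + x * g x := fun x => by
    have := sub_smul_dslope f 0 x
    rw [sub_zero, smul_eq_mul, hf0, ← hg] at this
    linarith
  -- Since `|w| ≤ 1`, smallness of `κ n` puts all arguments near `0` at once, which supplies the
  -- dominating bound.
  have hev : ∀ᶠ n in atTop, ∀ x, |g (κ n * w x)| ≤ 2 := by
    obtain ⟨δ, hδ, hball⟩ := Metric.eventually_nhds_iff.1
      (hgc.eventually (Metric.ball_mem_nhds (1 : ℝ) one_pos))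
    filter_upwards [Metric.tendsto_nhds.1 hκ δ hδ] with n hn x
    have h1 : dist (κ n * w x) 0 < δ := by
      rw [dist_zero_right] at hn ⊢
      rw [norm_mul]
      exact (mul_le_of_le_one_right (norm_nonneg _) (hw1 x)).trans_lt hn
    have h2 : |g (κ n * w x) - 1| < 1 := hball h1
    rw [abs_lt] at h2
    rw [abs_le]
    constructor <;> linarith [h2.1, h2.2]
  refine ⟨fun n => ∫ x, φ x * w x * g (κ n * w x) ∂μ, ?_, ?_⟩
  · have hK0 : ∀ x, |φ x * w x| ≤ K := fun x => by
      rw [abs_mul]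
      exact (mul_le_of_le_one_right (abs_nonneg _) (hw1 x)).trans (hK x)
    refine tendsto_integral_filter_of_dominated_convergence (fun _ => K * 2) ?_ ?_
      (integrable_const _) ?_
    · exact .of_forall fun n => by fun_prop
    · filter_upwards [hev] with n hn
      refine .of_forall fun x => ?_
      rw [Real.norm_eq_abs, abs_mul]
      exact mul_le_mul (hK0 x) (hn x) (abs_nonneg _) ((abs_nonneg _).trans (hK0 x))
    · refine .of_forall fun x => ?_
      have h1 : Tendsto (fun n => κ n * w x) atTop (𝓝 0) := by
        simpa using hκ.mul_const (w x)
      simpa using (hgc.comp h1).const_mul (φ x * w x)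
  · filter_upwards [hev] with n hn
    have hφi : Integrable φ μ := Integrable.of_bound hφ.aestronglyMeasurable K (.of_forall hK)
    have hi : Integrable (fun x => φ x * w x * g (κ n * w x)) μ := by
      refine Integrable.of_bound (by fun_prop) (K * 1 * 2) (.of_forall fun x => ?_)
      rw [Real.norm_eq_abs, abs_mul, abs_mul]
      have hK0 : 0 ≤ K := (abs_nonneg _).trans (hK x)
      exact mul_le_mul (mul_le_mul (hK x) (hw1 x) (abs_nonneg _) hK0) (hn x) (abs_nonneg _)
        (by positivity)
    rw [← integral_const_mul, ← integral_add hφi (hi.const_mul _)]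
    refine integral_congr_ae (.of_forall fun x => ?_)
    simp only [hfg (κ n * w x)]
    ring

section AxialLaw

variable {p : ℕ}

/-- The normalizing constant need not be evaluated: total mass one forces it to be the reciprocal of
the integral of `f (κ w)`, and the mass of the surface measure cancels in the ratio. -/
theorem integral_axialLaw (hp : 0 < p) (θ : Sph p) (κ : ℝ) {f : ℝ → ℝ} (hf : Measurable f)
    (hf0 : ∀ x, 0 ≤ f x) [hprob : IsProbabilityMeasure (axialLaw p θ κ f)] (φ : Sph p → ℝ) :
    ∫ x, φ x ∂axialLaw p θ κ f =
      (∫ x, φ x * f (κ * (inner ℝ (x : EuclideanSpace ℝ (Fin p))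
        (θ : EuclideanSpace ℝ (Fin p))) ^ 2) ∂uniformLaw p) /
      ∫ x, f (κ * (inner ℝ (x : EuclideanSpace ℝ (Fin p))
        (θ : EuclideanSpace ℝ (Fin p))) ^ 2) ∂uniformLaw p := by
  set C := normConst p κ f * Real.Gamma (((p : ℝ) - 1) / 2) /
    (2 * Real.pi ^ (((p : ℝ) - 1) / 2)) with hC
  set F : Sph p → ℝ := fun x => f (κ * (inner ℝ (x : EuclideanSpace ℝ (Fin p))
        (θ : EuclideanSpace ℝ (Fin p))) ^ 2) with hF
  have hd : ∀ x, axialDensity p θ κ f x = C * F x := fun x => rfl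
  have hFm : Measurable F := by fun_prop
  -- A negative constant would make `ENNReal.ofReal` truncate the density to zero, contradicting
  -- total mass one.
  have hC0 : 0 ≤ C := by
    by_contra! h
    have hz : axialLaw p θ κ f = 0 := by
      have : ∀ x, ENNReal.ofReal (axialDensity p θ κ f x) = 0 := fun x => by
        rw [hd, ENNReal.ofReal_eq_zero]
        exact mul_nonpos_of_nonpos_of_nonneg h.le (hf0 _)
      simp [axialLaw, this]
    have := hprob.measure_univ
    simp [hz] at this
  have key : ∀ ψ : Sph p → ℝ,
      ∫ x, ψ x ∂axialLaw p θ κ f = C * ∫ x, ψ x * F x ∂surfaceMeasure p := by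
    intro ψ
    rw [axialLaw, integral_withDensity_eq_integral_toReal_smul
      (by simp_rw [hd]; fun_prop) (.of_forall fun x => ENNReal.ofReal_lt_top),
      ← integral_const_mul]
    refine integral_congr_ae (.of_forall fun x => ?_)
    simp only [hd, smul_eq_mul]
    rw [ENNReal.toReal_ofReal (mul_nonneg hC0 (hf0 _))]
    ring
  have h1 : C * ∫ x, F x ∂surfaceMeasure p = 1 := by
    have := key fun _ => 1
    simpa using this.symm
  have hs : ((surfaceMeasure p Set.univ)⁻¹).toReal ≠ 0 :=
    ENNReal.toReal_ne_zero.2 ⟨ENNReal.inv_ne_zero.2 (measure_ne_top _ _),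
      ENNReal.inv_ne_top.2 (surfaceMeasure_univ_ne_zero hp)⟩
  rw [key, uniformLaw, integral_smul_measure, integral_smul_measure, smul_eq_mul, smul_eq_mul,
    mul_div_mul_left _ _ hs, eq_div_iff (right_ne_zero_of_mul_eq_one h1)]
  linear_combination (∫ x, φ x * F x ∂surfaceMeasure p) * h1

theorem IsAngular.measurable {f : ℝ → ℝ} (hf : IsAngular f) : Measurable f := hf.mono.measurable

theorem IsAngular.hasDerivAt {f : ℝ → ℝ} (hf : IsAngular f) : HasDerivAt f 1 0 := by
  have := hf.differentiable_near.self_of_nhds.hasDerivAt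
  rwa [hf.deriv_zero] at this

theorem abs_inner_sq_le_one (x θ : Sph p) : |(inner ℝ (x : EuclideanSpace ℝ (Fin p))
    (θ : EuclideanSpace ℝ (Fin p))) ^ 2| ≤ 1 := by
  have h := abs_real_inner_le_norm (x : EuclideanSpace ℝ (Fin p)) (θ : EuclideanSpace ℝ (Fin p))
  rw [norm_eq_of_mem_sphere, norm_eq_of_mem_sphere, mul_one] at h
  rw [abs_pow]
  exact pow_le_one₀ (abs_nonneg _) h

/-- Numerator and denominator are both expanded to first order in `κ n`. For centred `φ` the
numerator starts at order `κ n`, so the denominator matters only through its limit `1`. -/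
theorem tendsto_integral_axialLaw (hp : 0 < p) (θ : Sph p) {f : ℝ → ℝ} (hf : IsAngular f)
    {κ : ℕ → ℝ} {k : ℝ} (hk : Tendsto (fun n : ℕ => √(n : ℝ) * κ n) atTop (𝓝 k))
    (hprob : ∀ᶠ n in atTop, IsProbabilityMeasure (axialLaw p θ (κ n) f)) {φ : Sph p → ℝ}
    (hφ : Continuous φ) :
    Tendsto (fun n => ∫ x, φ x ∂axialLaw p θ (κ n) f) atTop (𝓝 (∫ x, φ x ∂uniformLaw p)) ∧
    (∫ x, φ x ∂uniformLaw p = 0 →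
      Tendsto (fun n : ℕ => √(n : ℝ) * ∫ x, φ x ∂axialLaw p θ (κ n) f) atTop
        (𝓝 (k * ∫ x, φ x * (inner ℝ (x : EuclideanSpace ℝ (Fin p))
        (θ : EuclideanSpace ℝ (Fin p))) ^ 2 ∂uniformLaw p))) := by
  have := isProbabilityMeasure_uniformLaw hp
  have hsq : Tendsto (fun n : ℕ => √(n : ℝ)) atTop atTop :=
    Real.tendsto_sqrt_atTop.comp tendsto_natCast_atTop_atTop
  have hκ : Tendsto κ atTop (𝓝 0) := by
    have h := (tendsto_inv_atTop_zero.comp hsq).mul hk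
    rw [zero_mul] at h
    refine h.congr' ?_
    filter_upwards [eventually_gt_atTop 0] with n hn
    have hs0 : √(n : ℝ) ≠ 0 := (Real.sqrt_pos.2 (by exact_mod_cast hn)).ne'
    simp [hs0]
  set w : Sph p → ℝ := fun x => (inner ℝ (x : EuclideanSpace ℝ (Fin p))
        (θ : EuclideanSpace ℝ (Fin p))) ^ 2 with hw
  have hwm : Measurable w := by fun_prop
  obtain ⟨K, hK⟩ := isCompact_univ.exists_bound_of_continuousOn hφ.continuousOn
  obtain ⟨h, hh, hint⟩ := exists_integral_mul_comp_expansion (μ := uniformLaw p) hwm hφ.measurable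
    (fun x => abs_inner_sq_le_one x θ) (fun x => hK x (Set.mem_univ x)) hf.measurable
    hf.hasDerivAt hf.map_zero hκ
  obtain ⟨h', hh', hint'⟩ := exists_integral_mul_comp_expansion (μ := uniformLaw p) hwm
    (measurable_const (a := (1 : ℝ))) (K := 1)
    (fun x => abs_inner_sq_le_one x θ) (fun x => by simp) hf.measurable
    hf.hasDerivAt hf.map_zero hκ
  have hden : Tendsto (fun n => 1 + κ n * h' n) atTop (𝓝 1) := by
    simpa using (hκ.mul hh').const_add 1
  have heq : ∀ᶠ n in atTop, ∫ x, φ x ∂axialLaw p θ (κ n) f =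
      (∫ x, φ x ∂uniformLaw p + κ n * h n) / (1 + κ n * h' n) := by
    filter_upwards [hprob, hint, hint'] with n hn h1 h2
    simp only [one_mul, integral_const, probReal_univ, smul_eq_mul] at h2
    rw [integral_axialLaw hp θ (κ n) hf.measurable hf.nonneg, ← h1, ← h2]
  refine ⟨?_, fun h0 => ?_⟩
  · have hl := ((hκ.mul hh).const_add (∫ x, φ x ∂uniformLaw p)).div hden one_ne_zero
    rw [zero_mul, add_zero, div_one] at hl
    exact hl.congr' (heq.mono fun n hn => hn.symm)
  · have hl := (hk.mul hh).div hden one_ne_zero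
    rw [div_one] at hl
    refine hl.congr' (heq.mono fun n hn => ?_)
    simp only [Pi.div_apply]
    rw [hn, h0]
    ring

end AxialLaw

end AxialUniformity
namespace AxialUniformity

/-! ### Extreme eigenvalues as extreme values of a quadratic form -/

section QuadraticForm

variable {p : ℕ}

@[simp]
theorem vecE_apply (A : Matrix (Fin p) (Fin p) ℝ) (i : Fin p × Fin p) : vecE A i = A i.2 i.1 := rfl

/-- The quadratic form on the unit sphere of the matrix with vectorization `a`. -/
noncomputable def quadOn (a : EuclideanSpace ℝ (Fin p × Fin p)) (y : Sph p) : ℝ :=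
  ∑ i, ∑ j, a (i, j) * ((y : EuclideanSpace ℝ (Fin p)) i * (y : EuclideanSpace ℝ (Fin p)) j)

/-- The extreme values of the quadratic form `quadOn a`. -/
noncomputable def quadExtremes (a : EuclideanSpace ℝ (Fin p × Fin p)) : ℝ × ℝ :=
  (sSup (quadOn a '' Set.univ), sInf (quadOn a '' Set.univ))

theorem continuous_uncurry_quadOn :
    Continuous (Function.uncurry (quadOn : EuclideanSpace ℝ (Fin p × Fin p) → Sph p → ℝ)) := by
  unfold Function.uncurry quadOn
  fun_prop

theorem continuous_quadOn (a : EuclideanSpace ℝ (Fin p × Fin p)) : Continuous (quadOn a) :=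
  continuous_uncurry_quadOn.comp (Continuous.prodMk_right a)

/-- Extrema of a jointly continuous function over a compact set depend continuously on the
parameter. Continuity holds on the whole space, whereas the extreme real eigenvalues are well
behaved only on symmetric matrices. -/
theorem continuous_quadExtremes :
    Continuous (quadExtremes : EuclideanSpace ℝ (Fin p × Fin p) → ℝ × ℝ) :=
  (isCompact_univ.continuous_sSup continuous_uncurry_quadOn).prodMk
    (isCompact_univ.continuous_sInf continuous_uncurry_quadOn)

theorem nonempty_sph (hp : 0 < p) : Nonempty (Sph p) :=
  ⟨⟨EuclideanSpace.single ⟨0, hp⟩ 1, by simp⟩⟩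

theorem isGreatest_quadExtremes_fst (hp : 0 < p) (a : EuclideanSpace ℝ (Fin p × Fin p)) :
    IsGreatest (quadOn a '' Set.univ) (quadExtremes a).1 := by
  have := nonempty_sph hp
  exact (isCompact_univ.image (continuous_quadOn a)).isGreatest_sSup
    (Set.univ_nonempty.image _)

theorem isLeast_quadExtremes_snd (hp : 0 < p) (a : EuclideanSpace ℝ (Fin p × Fin p)) :
    IsLeast (quadOn a '' Set.univ) (quadExtremes a).2 := by
  have := nonempty_sph hp
  exact (isCompact_univ.image (continuous_quadOn a)).isLeast_sInf
    (Set.univ_nonempty.image _)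

theorem quadOn_vecE (A : Matrix (Fin p) (Fin p) ℝ) (y : Sph p) :
    quadOn (vecE A) y = (y : EuclideanSpace ℝ (Fin p)).ofLp ⬝ᵥ
      A *ᵥ (y : EuclideanSpace ℝ (Fin p)).ofLp := by
  simp only [quadOn, vecE_apply, dotProduct, mulVec, Finset.mul_sum]
  rw [Finset.sum_comm]
  exact Finset.sum_congr rfl fun i _ => Finset.sum_congr rfl fun j _ => by ring

theorem exists_quadOn_eq_of_hasEigenvalue {A : Matrix (Fin p) (Fin p) ℝ} {l : ℝ}
    (hl : Module.End.HasEigenvalue (Matrix.toLin' A) l) : ∃ y : Sph p, quadOn (vecE A) y = l := by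
  obtain ⟨v, hv⟩ := hl.exists_hasEigenvector
  have hv1 : A *ᵥ v = l • v := by simpa using hv.apply_eq_smul
  set u : EuclideanSpace ℝ (Fin p) := WithLp.toLp 2 v with hu
  have hu0 : ‖u‖ ≠ 0 := by
    rw [norm_ne_zero_iff]
    intro h
    apply hv.2
    have := congrArg WithLp.ofLp h
    simpa [hu] using this
  refine ⟨⟨‖u‖⁻¹ • u, by simp [norm_smul, hu0]⟩, ?_⟩
  rw [quadOn_vecE]
  have h1 : ∑ i, v i * v i = ‖u‖ ^ 2 := by
    rw [EuclideanSpace.real_norm_sq_eq]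
    simp [hu, pow_two]
  simp only [WithLp.ofLp_smul, mulVec_smul, hu, hv1, dotProduct, Pi.smul_apply, smul_eq_mul]
  rw [← hu]
  calc ∑ i, ‖u‖⁻¹ * v i * (‖u‖⁻¹ * (l * v i)) = (‖u‖⁻¹) ^ 2 * l * ∑ i, v i * v i := by
        rw [Finset.mul_sum]; exact Finset.sum_congr rfl fun i _ => by ring
    _ = l := by rw [h1]; field_simp

/-- Lagrange multipliers: a constrained extremum of the form of a self-adjoint operator is an
eigenvector, with the Rayleigh quotient as eigenvalue. -/
theorem hasEigenvalue_of_isExtrOn {A : Matrix (Fin p) (Fin p) ℝ} (hA : A.IsSymm) {y : Sph p}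
    (hy : IsExtrOn (quadOn (vecE A)) Set.univ y) :
    Module.End.HasEigenvalue (Matrix.toLin' A) (quadOn (vecE A) y) := by
  set T := Matrix.toEuclideanCLM (n := Fin p) (𝕜 := ℝ) A with hT
  have hself : IsSelfAdjoint T := by
    refine IsSelfAdjoint.map ?_ _
    rw [IsSelfAdjoint, star_eq_conjTranspose, conjTranspose_eq_transpose_of_trivial]
    exact hA
  have hquad : ∀ z : Sph p, T.reApplyInnerSelf z = quadOn (vecE A) z := fun z => by
    rw [quadOn_vecE, ContinuousLinearMap.reApplyInnerSelf_apply, RCLike.re_to_real,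
      real_inner_comm, hT, Matrix.inner_toEuclideanCLM]
  have hy1 : ‖(y : EuclideanSpace ℝ (Fin p))‖ = 1 := norm_eq_of_mem_sphere y
  have hy0 : (y : EuclideanSpace ℝ (Fin p)) ≠ 0 := by
    intro h; simp [h] at hy1
  have hext : IsExtrOn T.reApplyInnerSelf (Metric.sphere 0 ‖(y : EuclideanSpace ℝ (Fin p))‖)
      (y : EuclideanSpace ℝ (Fin p)) := by
    rw [hy1]
    refine hy.imp (fun h z hz => ?_) (fun h z hz => ?_)
    · have := h (Set.mem_univ (⟨z, hz⟩ : Sph p))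
      simpa only [Set.mem_ofPred_eq, ← hquad] using this
    · have := h (Set.mem_univ (⟨z, hz⟩ : Sph p))
      simpa only [Set.mem_ofPred_eq, ← hquad] using this
  have hev := hself.hasEigenvector_of_isLocalExtrOn hy0 (hext.localize)
  have hr : T.rayleighQuotient y = quadOn (vecE A) y := by
    simp [ContinuousLinearMap.rayleighQuotient, hquad]
  rw [hr] at hev
  have happ : T y = quadOn (vecE A) y • (y : EuclideanSpace ℝ (Fin p)) := hev.apply_eq_smul
  refine Module.End.hasEigenvalue_of_hasEigenvector
    (x := (y : EuclideanSpace ℝ (Fin p)).ofLp) ⟨?_, ?_⟩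
  · rw [Module.End.mem_eigenspace_iff, toLin'_apply]
    have := congrArg WithLp.ofLp happ
    simpa [hT] using this
  · intro h
    exact hy0 (by ext i; simpa using congrFun h i)

/-- Rayleigh: the extreme eigenvalues of a symmetric matrix are the extreme values of its
quadratic form on the unit sphere. -/
theorem quadExtremes_vecE (hp : 0 < p) {A : Matrix (Fin p) (Fin p) ℝ} (hA : A.IsSymm) :
    quadExtremes (vecE A) = (maxEigenvalue A, minEigenvalue A) := by
  have hmax := isGreatest_quadExtremes_fst hp (vecE A)
  have hmin := isLeast_quadExtremes_snd hp (vecE A)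
  refine Prod.ext ?_ ?_
  · refine IsGreatest.unique ⟨?_, ?_⟩ (isGreatest_maxEigenvalue hp hA)
    · obtain ⟨y, -, hy⟩ := hmax.1
      rw [Set.mem_ofPred_eq, ← hy]
      refine hasEigenvalue_of_isExtrOn hA (Or.inr fun z hz => ?_)
      simpa only [Set.mem_ofPred_eq, hy] using hmax.2 ⟨z, hz, rfl⟩
    · intro l hl
      obtain ⟨y, rfl⟩ := exists_quadOn_eq_of_hasEigenvalue hl
      exact hmax.2 ⟨y, Set.mem_univ y, rfl⟩
  · refine IsLeast.unique ⟨?_, ?_⟩ (isLeast_minEigenvalue hp hA)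
    · obtain ⟨y, -, hy⟩ := hmin.1
      rw [Set.mem_ofPred_eq, ← hy]
      refine hasEigenvalue_of_isExtrOn hA (Or.inl fun z hz => ?_)
      simpa only [Set.mem_ofPred_eq, hy] using hmin.2 ⟨z, hz, rfl⟩
    · intro l hl
      obtain ⟨y, rfl⟩ := exists_quadOn_eq_of_hasEigenvalue hl
      exact hmin.2 ⟨y, Set.mem_univ y, rfl⟩

end QuadraticForm

/-! ### The score sum and its rotation invariance -/

section Score

variable {p : ℕ}

/-- `vec (p x x' - I_p)`. -/
noncomputable def score (x : Sph p) : EuclideanSpace ℝ (Fin p × Fin p) :=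
  vecE ((p : ℝ) • vecMulVec (x : EuclideanSpace ℝ (Fin p)).ofLp
    (x : EuclideanSpace ℝ (Fin p)).ofLp - 1)

theorem score_apply (x : Sph p) (i j : Fin p) :
    score x (i, j) = p * ((x : EuclideanSpace ℝ (Fin p)) i * (x : EuclideanSpace ℝ (Fin p)) j) -
      if i = j then 1 else 0 := by
  simp [score, vecMulVec_apply, Matrix.one_apply, eq_comm, mul_comm]

/-- `n^{-1/2} ∑ vec (p X_i X_i' - I_p)`, the vectorization of `√n (p S_n - I_p)`. -/
noncomputable def scoreSum {n : ℕ} (x : Fin n → Sph p) : EuclideanSpace ℝ (Fin p × Fin p) :=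
  (√(n : ℝ))⁻¹ • ∑ i, score (x i)

theorem continuous_score : Continuous (score : Sph p → EuclideanSpace ℝ (Fin p × Fin p)) := by
  refine (PiLp.continuous_toLp 2 _).comp (continuous_pi fun i => ?_)
  simp only [Matrix.vec, Matrix.sub_apply, Matrix.smul_apply, vecMulVec_apply, smul_eq_mul]
  fun_prop

theorem scoreSum_eq {n : ℕ} (x : Fin n → Sph p) :
    scoreSum x = vecE (√(n : ℝ) • ((p : ℝ) • sampleCov x - 1)) := by
  ext ⟨i, j⟩
  -- For `n = 0` the sum is empty and `√0 = 0`, so both sides vanish.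
  rcases Nat.eq_zero_or_pos n with rfl | hn
  · simp [scoreSum]
  have hs0 : √(n : ℝ) ≠ 0 := (Real.sqrt_pos.2 (by exact_mod_cast hn)).ne'
  have hss : √(n : ℝ) * √(n : ℝ) = n := Real.mul_self_sqrt (Nat.cast_nonneg n)
  simp only [scoreSum, PiLp.smul_apply, WithLp.ofLp_sum, Finset.sum_apply, score_apply, smul_eq_mul,
    vecE_apply, Matrix.smul_apply, Matrix.sub_apply, sampleCov, Matrix.sum_apply, vecMulVec_apply,
    Finset.sum_sub_distrib, ← Finset.mul_sum, Finset.sum_const, Finset.card_univ, Fintype.card_fin,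
    nsmul_eq_mul, Matrix.one_apply, eq_comm (a := j), mul_comm ((x _ : EuclideanSpace ℝ (Fin p)) j)]
  generalize √(n : ℝ) = s at hs0 hss
  rw [← hss]
  field_simp

theorem isSymm_sampleCov {n : ℕ} (x : Fin n → Sph p) : (sampleCov x).IsSymm := by
  ext i j
  simp [sampleCov, Matrix.sum_apply, vecMulVec_apply, mul_comm]

theorem quadOn_scoreSum {n : ℕ} (x : Fin n → Sph p) (y : Sph p) :
    quadOn (scoreSum x) y = √(n : ℝ) * (p * quadOn (vecE (sampleCov x)) y - 1) := by
  have hy : (y : EuclideanSpace ℝ (Fin p)).ofLp ⬝ᵥ (y : EuclideanSpace ℝ (Fin p)).ofLp = 1 := by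
    have := EuclideanSpace.real_norm_sq_eq (y : EuclideanSpace ℝ (Fin p))
    rw [norm_eq_of_mem_sphere, one_pow] at this
    simp [dotProduct, ← pow_two, ← this]
  rw [scoreSum_eq, quadOn_vecE, quadOn_vecE]
  simp [smul_mulVec, sub_mulVec, hy, dotProduct_sub]

/-- The map `t ↦ √n (p t - 1)` is monotone, so it carries greatest and least values to greatest and
least values. -/
theorem extremeStat_eq_quadExtremes (hp : 0 < p) {n : ℕ} (x : Fin n → Sph p) :
    extremeStat x = quadExtremes (scoreSum x) := by
  have hmono : Monotone fun t : ℝ => √(n : ℝ) * (p * t - 1) := fun s t hst => by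
    dsimp only
    gcongr
  have himage : quadOn (scoreSum x) '' Set.univ =
      (fun t : ℝ => √(n : ℝ) * (p * t - 1)) '' (quadOn (vecE (sampleCov x)) '' Set.univ) := by
    rw [Set.image_image]
    exact Set.image_congr fun y _ => quadOn_scoreSum x y
  have hmax := isGreatest_quadExtremes_fst hp (scoreSum x)
  have hmin := isLeast_quadExtremes_snd hp (scoreSum x)
  rw [himage] at hmax hmin
  have hq := quadExtremes_vecE hp (isSymm_sampleCov x)
  refine Prod.ext ?_ ?_
  · refine IsGreatest.unique ?_ hmax
    have := hmono.map_isGreatest (isGreatest_quadExtremes_fst hp (vecE (sampleCov x)))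
    rwa [hq] at this
  · refine IsLeast.unique ?_ hmin
    have := hmono.map_isLeast (isLeast_quadExtremes_snd hp (vecE (sampleCov x)))
    rwa [hq] at this

theorem quadOn_score_rotate (L : EuclideanSpace ℝ (Fin p) ≃ₗᵢ[ℝ] EuclideanSpace ℝ (Fin p))
    (x y : Sph p) : quadOn (score (rotate L x)) (rotate L y) = quadOn (score x) y := by
  -- The form depends on `x` and `y` only through their inner product, which an isometry preserves.
  have h : ∀ x y : Sph p, quadOn (score x) y = p * (inner ℝ (x : EuclideanSpace ℝ (Fin p))
      (y : EuclideanSpace ℝ (Fin p))) ^ 2 - 1 := by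
    intro x y
    have hy := EuclideanSpace.real_norm_sq_eq (y : EuclideanSpace ℝ (Fin p))
    rw [norm_eq_of_mem_sphere, one_pow] at hy
    simp only [quadOn, score_apply, sub_mul, Finset.sum_sub_distrib, ite_mul, one_mul, zero_mul,
      Finset.sum_ite_eq, Finset.mem_univ, if_true, ← pow_two, ← hy]
    rw [pow_two (inner ℝ _ _), PiLp.inner_apply, Finset.sum_mul_sum, Finset.mul_sum]
    congr 1
    refine Finset.sum_congr rfl fun i _ => ?_
    rw [Finset.mul_sum]
    refine Finset.sum_congr rfl fun j _ => ?_
    simp only [RCLike.inner_apply, RCLike.conj_to_real]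
    ring
  rw [h, h, coe_rotate, coe_rotate, LinearIsometryEquiv.inner_map_map]

theorem quadOn_scoreSum_eq_sum {n : ℕ} (x : Fin n → Sph p) (y : Sph p) :
    quadOn (scoreSum x) y = (√(n : ℝ))⁻¹ * ∑ k, quadOn (score (x k)) y := by
  simp only [quadOn, scoreSum, PiLp.smul_apply, WithLp.ofLp_sum, Finset.sum_apply, smul_eq_mul,
    Finset.mul_sum, Finset.sum_mul]
  rw [Finset.sum_comm (γ := Fin n)]
  refine Finset.sum_congr rfl fun i _ => ?_
  rw [Finset.sum_comm]
  exact Finset.sum_congr rfl fun k _ => Finset.sum_congr rfl fun j _ => by ring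

theorem quadExtremes_scoreSum_rotate
    (L : EuclideanSpace ℝ (Fin p) ≃ₗᵢ[ℝ] EuclideanSpace ℝ (Fin p)) {n : ℕ} (x : Fin n → Sph p) :
    quadExtremes (scoreSum fun i => rotate L (x i)) = quadExtremes (scoreSum x) := by
  have h : ∀ y, quadOn (scoreSum fun i => rotate L (x i)) (rotate L y) =
      quadOn (scoreSum x) y := fun y => by
    simp only [quadOn_scoreSum_eq_sum, quadOn_score_rotate]
  have himage : quadOn (scoreSum fun i => rotate L (x i)) '' Set.univ =
      quadOn (scoreSum x) '' Set.univ := by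
    ext t
    constructor
    · rintro ⟨y, -, rfl⟩
      exact ⟨rotate L.symm y, Set.mem_univ _, by rw [← h, rotate_rotate_symm]⟩
    · rintro ⟨y, -, rfl⟩
      exact ⟨rotate L y, Set.mem_univ _, h y⟩
  simp only [quadExtremes, himage]

end Score

end AxialUniformity
namespace AxialUniformity

/-! ### Moments of the score and the covariance matrix `V_p` -/

section ScoreMoments

variable {p : ℕ}

theorem inner_score (x : Sph p) (s : EuclideanSpace ℝ (Fin p × Fin p)) :
    inner ℝ (score x) s = p * quadOn s x - ∑ i, s (i, i) := by
  rw [PiLp.inner_apply, Fintype.sum_prod_type]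
  simp only [RCLike.inner_apply, RCLike.conj_to_real, score_apply, quadOn, mul_sub, mul_ite,
    mul_one, mul_zero, Finset.sum_sub_distrib, Finset.sum_ite_eq, Finset.mem_univ, if_true,
    Finset.mul_sum]
  congr 1
  exact Finset.sum_congr rfl fun i _ => Finset.sum_congr rfl fun j _ => by ring

theorem integral_coord_two (hp : 0 < p) (i j : Fin p) :
    ∫ x : Sph p, (x : EuclideanSpace ℝ (Fin p)) i * (x : EuclideanSpace ℝ (Fin p)) j
      ∂uniformLaw p = (if i = j then 1 else 0) / p := by
  have h := integral_inner_mul_inner hp (EuclideanSpace.single i (1 : ℝ))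
    (EuclideanSpace.single j 1)
  simpa [EuclideanSpace.inner_single_right, PiLp.single_apply, eq_comm] using h

theorem integral_coord_four (hp : 0 < p) (i j k l : Fin p) :
    ∫ x : Sph p, (x : EuclideanSpace ℝ (Fin p)) i * (x : EuclideanSpace ℝ (Fin p)) j *
      ((x : EuclideanSpace ℝ (Fin p)) k * (x : EuclideanSpace ℝ (Fin p)) l) ∂uniformLaw p =
    ((if i = j then 1 else 0) * (if k = l then 1 else 0) +
      (if i = k then 1 else 0) * (if j = l then 1 else 0) +
      (if i = l then 1 else 0) * (if j = k then 1 else 0)) / (p * (p + 2)) := by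
  have h := integral_inner_mul_four hp (EuclideanSpace.single i (1 : ℝ))
    (EuclideanSpace.single j 1) (EuclideanSpace.single k 1) (EuclideanSpace.single l 1)
  have hx : ∀ (x : Sph p) (i : Fin p), inner ℝ (x : EuclideanSpace ℝ (Fin p))
      (EuclideanSpace.single i (1 : ℝ)) = (x : EuclideanSpace ℝ (Fin p)) i := fun x i => by
    simp [EuclideanSpace.inner_single_right]
  have hs : ∀ i j : Fin p, inner ℝ (EuclideanSpace.single i (1 : ℝ))
      (EuclideanSpace.single j (1 : ℝ)) = if i = j then 1 else 0 := fun i j => by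
    simp [EuclideanSpace.inner_single_left, PiLp.single_apply]
  simpa only [hx, hs] using h

theorem integral_quadOn (hp : 0 < p) (s : EuclideanSpace ℝ (Fin p × Fin p)) :
    ∫ x, quadOn s x ∂uniformLaw p = (∑ i, s (i, i)) / p := by
  have := isProbabilityMeasure_uniformLaw hp
  have hi : ∀ i j : Fin p, Integrable (fun x : Sph p => s (i, j) *
      ((x : EuclideanSpace ℝ (Fin p)) i * (x : EuclideanSpace ℝ (Fin p)) j)) (uniformLaw p) :=
    fun i j => integrable_of_continuous (by fun_prop)
  simp only [quadOn]
  rw [integral_finsetSum _ fun i _ => integrable_finsetSum _ fun j _ => hi i j]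
  simp_rw [integral_finsetSum _ fun j _ => hi _ j, integral_const_mul, integral_coord_two hp]
  simp [div_eq_mul_inv, Finset.sum_mul]

theorem integral_quadOn_mul_quadOn (hp : 0 < p) (s t : EuclideanSpace ℝ (Fin p × Fin p)) :
    ∫ x, quadOn s x * quadOn t x ∂uniformLaw p =
      ((∑ i, s (i, i)) * (∑ i, t (i, i)) + ∑ i, ∑ j, s (i, j) * t (i, j) +
        ∑ i, ∑ j, s (i, j) * t (j, i)) / (p * (p + 2)) := by
  have := isProbabilityMeasure_uniformLaw hp
  have hst : ∀ x : Sph p, quadOn s x * quadOn t x = ∑ i, ∑ j, ∑ k, ∑ l, s (i, j) * t (k, l) *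
      ((x : EuclideanSpace ℝ (Fin p)) i * (x : EuclideanSpace ℝ (Fin p)) j *
      ((x : EuclideanSpace ℝ (Fin p)) k * (x : EuclideanSpace ℝ (Fin p)) l)) := fun x => by
    simp only [quadOn, Finset.sum_mul]
    refine Finset.sum_congr rfl fun i _ => Finset.sum_congr rfl fun j _ => ?_
    simp only [Finset.mul_sum]
    exact Finset.sum_congr rfl fun k _ => Finset.sum_congr rfl fun l _ => by ring
  have hi : ∀ i j k l : Fin p, Integrable (fun x : Sph p => s (i, j) * t (k, l) *
      ((x : EuclideanSpace ℝ (Fin p)) i * (x : EuclideanSpace ℝ (Fin p)) j *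
      ((x : EuclideanSpace ℝ (Fin p)) k * (x : EuclideanSpace ℝ (Fin p)) l))) (uniformLaw p) :=
    fun i j k l => integrable_of_continuous (by fun_prop)
  simp_rw [hst]
  rw [integral_finsetSum _ fun i _ => integrable_finsetSum _ fun j _ =>
    integrable_finsetSum _ fun k _ => integrable_finsetSum _ fun l _ => hi i j k l]
  simp_rw [integral_finsetSum _ fun j _ => integrable_finsetSum _ fun k _ =>
    integrable_finsetSum _ fun l _ => hi _ j k l,
    integral_finsetSum _ fun k _ => integrable_finsetSum _ fun l _ => hi _ _ k l,
    integral_finsetSum _ fun l _ => hi _ _ _ l, integral_const_mul, integral_coord_four hp,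
    mul_div_assoc', ← Finset.sum_div]
  congr 1
  simp only [mul_add, Finset.sum_add_distrib, mul_ite, mul_one, mul_zero, Finset.sum_ite_eq,
    Finset.sum_ite_irrel, Finset.sum_const_zero, Finset.mem_univ, if_true, Finset.sum_mul,
    Finset.mul_sum]
  congr 2
  exact Finset.sum_comm

theorem integral_inner_score (hp : 0 < p) (s : EuclideanSpace ℝ (Fin p × Fin p)) :
    ∫ x, inner ℝ (score x) s ∂uniformLaw p = 0 := by
  have := isProbabilityMeasure_uniformLaw hp
  have hp0 : (p : ℝ) ≠ 0 := by positivity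
  simp_rw [inner_score]
  rw [integral_sub ((integrable_of_continuous (continuous_quadOn s)).const_mul _)
    (integrable_const _), integral_const_mul, integral_quadOn hp]
  simp only [integral_const, probReal_univ, one_smul]
  field_simp
  ring

/-- This is the drift caused by the alternative. Since `(x'θ)²` is the quadratic form of `θθ'`,
which has trace one, the product formula for two quadratic forms applies. -/
theorem integral_inner_score_mul_sq (hp : 0 < p) (s : EuclideanSpace ℝ (Fin p × Fin p))
    (θ : Sph p) :
    ∫ x, inner ℝ (score x) s * (inner ℝ (x : EuclideanSpace ℝ (Fin p))
      (θ : EuclideanSpace ℝ (Fin p))) ^ 2 ∂uniformLaw p =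
      2 / (p * (p + 2)) * inner ℝ (score θ) s := by
  have := isProbabilityMeasure_uniformLaw hp
  have hp0 : (p : ℝ) ≠ 0 := by positivity
  have hp2 : (p : ℝ) + 2 ≠ 0 := by positivity
  set t : EuclideanSpace ℝ (Fin p × Fin p) := vecE (vecMulVec
    (θ : EuclideanSpace ℝ (Fin p)).ofLp (θ : EuclideanSpace ℝ (Fin p)).ofLp) with ht
  have htij : ∀ i j, t (i, j) = (θ : EuclideanSpace ℝ (Fin p)) i *
      (θ : EuclideanSpace ℝ (Fin p)) j := fun i j => by
    simp [ht, vecMulVec_apply, mul_comm]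
  have hw : ∀ x : Sph p, (inner ℝ (x : EuclideanSpace ℝ (Fin p))
      (θ : EuclideanSpace ℝ (Fin p))) ^ 2 = quadOn t x := fun x => by
    simp only [quadOn, htij]
    rw [pow_two, PiLp.inner_apply, Finset.sum_mul_sum]
    refine Finset.sum_congr rfl fun i _ => Finset.sum_congr rfl fun j _ => ?_
    simp only [RCLike.inner_apply, RCLike.conj_to_real]
    ring
  have htr : ∑ i, t (i, i) = 1 := by
    have h := EuclideanSpace.real_norm_sq_eq (θ : EuclideanSpace ℝ (Fin p))
    rw [norm_eq_of_mem_sphere, one_pow] at h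
    simp only [htij, ← pow_two, ← h]
  have hst : ∑ i, ∑ j, s (i, j) * t (i, j) = quadOn s θ := by simp only [quadOn, htij]
  have hst' : ∑ i, ∑ j, s (i, j) * t (j, i) = quadOn s θ := by
    simp only [quadOn, htij, mul_comm]
  have hsplit : ∀ x : Sph p, inner ℝ (score x) s * quadOn t x =
      p * (quadOn s x * quadOn t x) - (∑ i, s (i, i)) * quadOn t x := fun x => by
    rw [inner_score]; ring
  simp_rw [hw, hsplit]
  have hmul : Integrable (fun x => quadOn s x * quadOn t x) (uniformLaw p) :=
    integrable_of_continuous ((continuous_quadOn s).mul (continuous_quadOn t))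
  rw [integral_sub (hmul.const_mul _) ((integrable_of_continuous (continuous_quadOn t)).const_mul _), integral_const_mul,
    integral_const_mul, integral_quadOn hp, integral_quadOn_mul_quadOn hp, htr, hst, hst',
    inner_score]
  field_simp
  ring

theorem integral_inner_score_sq (hp : 0 < p) (s : EuclideanSpace ℝ (Fin p × Fin p)) :
    ∫ x, inner ℝ (score x) s ^ 2 ∂uniformLaw p =
      p / (p + 2) * (∑ i, ∑ j, s (i, j) * s (i, j) + ∑ i, ∑ j, s (i, j) * s (j, i)) -
        2 / (p + 2) * (∑ i, s (i, i)) ^ 2 := by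
  have := isProbabilityMeasure_uniformLaw hp
  have hp0 : (p : ℝ) ≠ 0 := by positivity
  have hp2 : (p : ℝ) + 2 ≠ 0 := by positivity
  have hsplit : ∀ x : Sph p, inner ℝ (score x) s ^ 2 = p ^ 2 * (quadOn s x * quadOn s x) -
      (2 * p * (∑ i, s (i, i)) * quadOn s x - (∑ i, s (i, i)) ^ 2) := fun x => by
    rw [inner_score]; ring
  simp_rw [hsplit]
  have h1 : Integrable (quadOn s) (uniformLaw p) :=
    integrable_of_continuous (continuous_quadOn s)
  have h2 : Integrable (fun x => quadOn s x * quadOn s x) (uniformLaw p) :=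
    integrable_of_continuous ((continuous_quadOn s).mul (continuous_quadOn s))
  have h3 : Integrable (fun x => 2 * p * (∑ i, s (i, i)) * quadOn s x - (∑ i, s (i, i)) ^ 2)
      (uniformLaw p) := (h1.const_mul _).sub (integrable_const _)
  rw [integral_sub (h2.const_mul _) h3, integral_sub (h1.const_mul _) (integrable_const _), integral_const_mul,
    integral_const_mul, integral_quadOn hp, integral_quadOn_mul_quadOn hp]
  simp only [integral_const, probReal_univ, one_smul]
  field_simp
  ring

theorem commMatrix_apply (a b : Fin p × Fin p) :
    commMatrix p a b = if a.1 = b.2 ∧ a.2 = b.1 then 1 else 0 := by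
  simp only [commMatrix, Matrix.sum_apply, kroneckerMap_apply, Matrix.single_apply]
  rw [Finset.sum_eq_single a.1, Finset.sum_eq_single a.2]
  · by_cases h1 : a.1 = b.2 <;> by_cases h2 : a.2 = b.1 <;> simp [h1, h2]
  · intro j _ hj
    simp [hj]
  · simp
  · intro i _ hi
    simp [hi]
  · simp

theorem JMatrix_apply (a b : Fin p × Fin p) :
    JMatrix p a b = (if a.1 = a.2 then 1 else 0) * (if b.1 = b.2 then 1 else 0) := by
  simp [JMatrix, vecMulVec_apply, Matrix.vec, Matrix.one_apply, eq_comm]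

theorem VMatrix_mulVec (s : Fin p × Fin p → ℝ) (i j : Fin p) :
    (VMatrix p *ᵥ s) (i, j) = p / (p + 2) * (s (i, j) + s (j, i)) -
      2 / (p + 2) * ((if i = j then 1 else 0) * ∑ k, s (k, k)) := by
  have hK : (commMatrix p *ᵥ s) (i, j) = s (j, i) := by
    simp only [mulVec, dotProduct, commMatrix_apply]
    rw [Finset.sum_eq_single (j, i)]
    · simp
    · rintro ⟨k, l⟩ - hkl
      have : ¬ (i = l ∧ j = k) := fun h => hkl (by rw [h.1, h.2])
      simp [this]
    · simp
  have hJ : (JMatrix p *ᵥ s) (i, j) = (if i = j then 1 else 0) * ∑ k, s (k, k) := by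
    simp only [mulVec, dotProduct, JMatrix_apply, mul_assoc, ← Finset.mul_sum]
    rw [Fintype.sum_prod_type]
    simp
  simp only [VMatrix, sub_mulVec, smul_mulVec, add_mulVec, one_mulVec, Pi.sub_apply,
    Pi.smul_apply, Pi.add_apply, hK, hJ, smul_eq_mul]

/-- Identifies `V_p` as the covariance of the score under the uniform law; its positive
semidefiniteness follows. -/
theorem dotProduct_VMatrix_mulVec (hp : 0 < p) (s : EuclideanSpace ℝ (Fin p × Fin p)) :
    s.ofLp ⬝ᵥ VMatrix p *ᵥ s.ofLp = ∫ x, inner ℝ (score x) s ^ 2 ∂uniformLaw p := by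
  rw [integral_inner_score_sq hp]
  simp only [dotProduct, Fintype.sum_prod_type, VMatrix_mulVec]
  generalize hT : ∑ k, s (k, k) = T
  simp only [mul_sub, mul_add, Finset.sum_sub_distrib, Finset.sum_add_distrib, ite_mul, one_mul,
    zero_mul, mul_ite, mul_zero, Finset.sum_ite_eq, Finset.mem_univ, if_true, ← Finset.sum_mul, hT,
    mul_left_comm (s _) (p / (p + 2) : ℝ), ← Finset.mul_sum]
  ring

theorem posSemidef_VMatrix (hp : 0 < p) : (VMatrix p).PosSemidef := by
  refine Matrix.PosSemidef.of_dotProduct_mulVec_nonneg ?_ fun s => ?_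
  · rw [Matrix.IsHermitian, conjTranspose_eq_transpose_of_trivial]
    have hK : (commMatrix p)ᵀ = commMatrix p := by
      ext a b
      rw [transpose_apply, commMatrix_apply, commMatrix_apply]
      exact if_congr ⟨fun h => ⟨h.2.symm, h.1.symm⟩, fun h => ⟨h.2.symm, h.1.symm⟩⟩ rfl rfl
    have hJ : (JMatrix p)ᵀ = JMatrix p := by
      ext a b
      rw [transpose_apply, JMatrix_apply, JMatrix_apply, mul_comm]
    simp [VMatrix, hK, hJ]
  · have h := dotProduct_VMatrix_mulVec hp (WithLp.toLp 2 s)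
    simp only [star_trivial]
    rw [h]
    exact integral_nonneg fun x => sq_nonneg _

end ScoreMoments

/-! ### Convergence in distribution of the score sum and of the extremes -/

section Convergence

variable {p : ℕ} {Ω' : Type*} [MeasurableSpace Ω'] {P' : Measure Ω'}
  {Z : Ω' → Matrix (Fin p) (Fin p) ℝ}

theorem ae_isSymm_of_hasLaw (hp : 0 < p)
    (hZ : HasLaw (fun ω => vecE (Z ω)) (multivariateGaussian 0 (VMatrix p)) P') :
    ∀ᵐ ω ∂P', (Z ω).IsSymm := by
  have key : ∀ i j : Fin p, ∀ᵐ ω ∂P', Z ω i j = Z ω j i := by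
    intro i j
    -- Pairing with `u` reads off `Z i j - Z j i`. Being antisymmetric, `u` lies in the kernel of
    -- `V_p`, so this difference has variance zero and mean zero.
    set u : EuclideanSpace ℝ (Fin p × Fin p) :=
      EuclideanSpace.single (j, i) 1 - EuclideanSpace.single (i, j) 1 with hu
    have hmem : MemLp id 2 (multivariateGaussian 0 (VMatrix p)) := IsGaussian.memLp_two_id
    have hanti : ∀ k l, u (k, l) = - u (l, k) := fun k l => by
      simp only [hu, PiLp.sub_apply, PiLp.single_apply, Prod.mk.injEq, and_comm]
      ring
    have hdiag : ∀ k, u (k, k) = 0 := fun k => by linarith [hanti k k]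
    have hV : VMatrix p *ᵥ u.ofLp = 0 := by
      ext ⟨k, l⟩
      rw [VMatrix_mulVec, hanti k l]
      simp [hdiag]
    have hvar : Var[fun z => inner ℝ u z; multivariateGaussian 0 (VMatrix p)] = 0 := by
      rw [← covarianceBilin_self hmem, covarianceBilin_multivariateGaussian
        (posSemidef_VMatrix hp), hV, dotProduct_zero]
    have hmem' : MemLp (fun z => inner ℝ u z) 2 (multivariateGaussian 0 (VMatrix p)) :=
      hmem.const_inner u
    have h0 : ∫ z, inner ℝ u z ∂multivariateGaussian 0 (VMatrix p) = 0 := by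
      have h := integral_inner (𝕜 := ℝ) (IsGaussian.integrable_fun_id
        (μ := multivariateGaussian 0 (VMatrix p))) u
      rw [h, integral_id_multivariateGaussian, inner_zero_right]
    have hae := ae_eq_integral_of_variance_eq_zero hmem' hvar
    rw [h0] at hae
    have hω := (hZ.ae_iff (p := fun z => inner ℝ u z = 0)
      (measurableSet_setOfPred.1 (measurableSet_eq_fun (by fun_prop) (by fun_prop)))).2 hae
    filter_upwards [hω] with ω h
    rw [hu, inner_sub_left, EuclideanSpace.inner_single_left, EuclideanSpace.inner_single_left]
      at h
    simp only [vecE_apply, map_one, one_mul] at h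
    linarith
  have hall : ∀ᵐ ω ∂P', ∀ i j : Fin p, Z ω i j = Z ω j i :=
    ae_all_iff.2 fun i => ae_all_iff.2 fun j => key i j
  filter_upwards [hall] with ω h
  ext i j
  exact h j i

variable {Ω : ℕ → Type*} [∀ n, MeasurableSpace (Ω n)] {P : ∀ n, Measure (Ω n)}
  {X : ∀ n : ℕ, Fin n → Ω n → Sph p}

/-- Only eventually: with `n = 0` there is no observation, and `ν 0` is unconstrained. -/
theorem IsRandomSample.eventually_isProbabilityMeasure [∀ n, IsProbabilityMeasure (P n)]
    {ν : ℕ → Measure (Sph p)}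
    (hX : ∀ n, IsRandomSample (X n) (ν n) (P n)) :
    ∀ᶠ n in atTop, IsProbabilityMeasure (ν n) := by
  filter_upwards [eventually_gt_atTop 0] with n hn
  exact ((hX n).hasLaw ⟨0, hn⟩).isProbabilityMeasure_iff.1 inferInstance

theorem charFun_map_scoreSum {n : ℕ} {ν : Measure (Sph p)} (hX : IsRandomSample (X n) ν (P n))
    (s : EuclideanSpace ℝ (Fin p × Fin p)) :
    charFun ((P n).map fun ω => scoreSum fun i => X n i ω) s =
      (∫ x, Complex.exp (((√(n : ℝ))⁻¹ * inner ℝ (score x) s : ℝ) * Complex.I) ∂ν) ^ n := by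
  have hsm : Measurable (score : Sph p → _) := continuous_score.measurable
  have hm : ∀ i, AEMeasurable (fun ω => score (X n i ω)) (P n) := fun i =>
    hsm.comp_aemeasurable (hX.hasLaw i).aemeasurable
  have hind : iIndepFun (fun i ω => score (X n i ω)) (P n) :=
    hX.indep.comp (fun _ => score) fun _ => hsm
  simp only [scoreSum]
  rw [charFun_map_smul_comp (Finset.aemeasurable_fun_sum _ fun i _ => hm i),
    hind.charFun_map_fun_sum_eq_prod hm, Finset.prod_apply, Finset.prod_congr rfl, Finset.prod_const,
    Finset.card_univ, Fintype.card_fin]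
  intro i _
  have hmap : (P n).map (fun ω => score (X n i ω)) = ν.map score := by
    rw [← (hX.hasLaw i).map_eq, AEMeasurable.map_map_of_aemeasurable hsm.aemeasurable
      (hX.hasLaw i).aemeasurable]
    rfl
  rw [hmap, charFun_apply, integral_map hsm.aemeasurable (by fun_prop)]
  simp only [inner_smul_right]

/-- Central limit theorem for `√n (p S_n - I_p)`: if the means of the scores under the sampling
laws `ν n` are asymptotically `n^{-1/2} B` and their second moments are asymptotically those of the
uniform law, the limit is the law of `Z` shifted by `B`. -/
theorem tendstoInDistribution_scoreSum [IsProbabilityMeasure P']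
    [∀ n, IsProbabilityMeasure (P n)] (hp : 0 < p)
    (hZ : HasLaw (fun ω => vecE (Z ω)) (multivariateGaussian 0 (VMatrix p)) P')
    {ν : ℕ → Measure (Sph p)} (hX : ∀ n, IsRandomSample (X n) (ν n) (P n))
    {B : EuclideanSpace ℝ (Fin p × Fin p)}
    (hb : ∀ s, Tendsto (fun n : ℕ => √(n : ℝ) * ∫ x, inner ℝ (score x) s ∂ν n) atTop
      (𝓝 (inner ℝ B s)))
    (hv : ∀ s, Tendsto (fun n : ℕ => ∫ x, inner ℝ (score x) s ^ 2 ∂ν n) atTop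
      (𝓝 (∫ x, inner ℝ (score x) s ^ 2 ∂uniformLaw p))) :
    TendstoInDistribution (fun n ω => scoreSum fun i => X n i ω) atTop
      (fun ω => vecE (Z ω) + B) P P' where
  forall_aemeasurable n := by
    have hsm : Measurable (score : Sph p → _) := continuous_score.measurable
    have h : AEMeasurable (fun ω => ∑ i, score (X n i ω)) (P n) :=
      Finset.aemeasurable_fun_sum _ fun i _ =>
        hsm.comp_aemeasurable ((hX n).hasLaw i).aemeasurable
    exact h.const_smul (√(n : ℝ))⁻¹
  aemeasurable_limit := hZ.aemeasurable.add_const B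
  tendsto := by
    refine ProbabilityMeasure.tendsto_iff_tendsto_charFun.2 fun s => ?_
    have hlim : charFun (P'.map fun ω => vecE (Z ω) + B) s =
        Complex.exp ((inner ℝ B s : ℝ) * Complex.I -
          ((∫ x, inner ℝ (score x) s ^ 2 ∂uniformLaw p : ℝ) : ℂ) / 2) := by
      have hmap : (P'.map fun ω => vecE (Z ω) + B) =
          (multivariateGaussian 0 (VMatrix p)).map (· + B) := by
        rw [← hZ.map_eq, AEMeasurable.map_map_of_aemeasurable (by fun_prop) hZ.aemeasurable]
        rfl
      rw [hmap, charFun_map_add_const, charFun_multivariateGaussian (posSemidef_VMatrix hp),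
        dotProduct_VMatrix_mulVec hp, ← Complex.exp_add]
      simp only [inner_zero_right, Complex.ofReal_zero, zero_mul, zero_sub]
      congr 1
      ring
    simp only [ProbabilityMeasure.coe_mk]
    rw [hlim]
    simp_rw [charFun_map_scoreSum (hX _)]
    have hcont : Continuous fun x : Sph p => (inner ℝ (score x) s : ℝ) :=
      continuous_score.inner continuous_const
    obtain ⟨K, hK⟩ := isCompact_univ.exists_bound_of_continuousOn hcont.continuousOn
    exact tendsto_integral_cexp_pow (IsRandomSample.eventually_isProbabilityMeasure hX)
      hcont.measurable (fun x => hK x (Set.mem_univ x)) (hb s) (hv s)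

/-- Continuous mapping, with limit extremes turned back into eigenvalues on the almost sure event
that `Z` is symmetric. The auxiliary sample `Y` leaves room for a rotated version of `X` with the
same extremes. -/
theorem tendstoInDistribution_extremeStat [IsProbabilityMeasure P']
    [∀ n, IsProbabilityMeasure (P n)] (hp : 0 < p)
    (hZ : HasLaw (fun ω => vecE (Z ω)) (multivariateGaussian 0 (VMatrix p)) P')
    {Y : ∀ n : ℕ, Fin n → Ω n → Sph p} {A : Matrix (Fin p) (Fin p) ℝ} (hA : A.IsSymm)
    (h : TendstoInDistribution (fun n ω => scoreSum fun i => Y n i ω) atTop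
      (fun ω => vecE (Z ω) + vecE A) P P')
    (hXY : ∀ n ω, quadExtremes (scoreSum fun i => Y n i ω) =
      quadExtremes (scoreSum fun i => X n i ω)) :
    TendstoInDistribution (fun n ω => extremeStat (fun i => X n i ω)) atTop
      (fun ω => (maxEigenvalue (Z ω + A), minEigenvalue (Z ω + A))) P P' := by
  refine (h.continuous_comp continuous_quadExtremes).congr (fun n => .of_forall fun ω => ?_) ?_
  · simp only [Function.comp_apply, hXY, extremeStat_eq_quadExtremes hp]
  · filter_upwards [ae_isSymm_of_hasLaw hp hZ] with ω hω
    simp only [Function.comp_apply]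
    rw [← quadExtremes_vecE hp (hω.add hA)]
    rfl

theorem isSymm_WMatrix (τ : ℝ) : (WMatrix p τ).IsSymm := isSymm_diagonal _

/-- At a basis vector, `p e e' - I` is diagonal with one entry `p - 1` and the others `-1`; the
first or last vector is taken according to the sign of `τ`. -/
theorem exists_score_eq_vecE_WMatrix (hp : 0 < p) (τ : ℝ) :
    ∃ e : Sph p, score e = vecE (WMatrix p τ) := by
  have key : ∀ k : Fin p, (∀ i : Fin p, (if 0 ≤ τ then (if i.val = 0 then (p : ℝ) - 1 else -1)
      else (if i.val + 1 = p then (p : ℝ) - 1 else -1)) = if i = k then (p : ℝ) - 1 else -1) →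
      ∃ e : Sph p, score e = vecE (WMatrix p τ) := by
    intro k hk
    refine ⟨⟨EuclideanSpace.single k 1, by simp⟩, ?_⟩
    ext ⟨i, j⟩
    rw [score_apply, vecE_apply, WMatrix, diagonal_apply, hk]
    simp only [PiLp.single_apply]
    by_cases hij : j = i
    · subst hij
      by_cases hjk : j = k <;> simp [hjk]
    · have hij' : i ≠ j := fun h => hij h.symm
      by_cases hik : i = k
      · have hjk : j ≠ k := fun h => hij (h.trans hik.symm)
        simp [hij, hij', hjk]
      · simp [hij, hij', hik]
  rcases le_or_gt 0 τ with hτ | hτ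
  · refine key ⟨0, hp⟩ fun i => ?_
    simp [hτ, Fin.ext_iff]
  · refine key ⟨p - 1, by omega⟩ fun i => ?_
    have : (i.val + 1 = p) ↔ i = ⟨p - 1, by omega⟩ := by
      rw [Fin.ext_iff]; dsimp only; omega
    simp only [not_le.2 hτ, if_false, this]

/-- The axial density involves `x` and `θ` only through their inner product, and surface measure is
invariant, so rotating the data rotates `θ`. -/
theorem IsRandomSample.rotate {n : ℕ} {θ : Sph p} {κ : ℝ} {f : ℝ → ℝ} (hf : Measurable f)
    (hX : IsRandomSample (X n) (axialLaw p θ κ f) (P n))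
    (L : EuclideanSpace ℝ (Fin p) ≃ₗᵢ[ℝ] EuclideanSpace ℝ (Fin p)) :
    IsRandomSample (fun i ω => rotate L (X n i ω)) (axialLaw p (rotate L θ) κ f) (P n) where
  hasLaw i := by
    refine HasLaw.fun_comp ⟨(continuous_rotate L).measurable.aemeasurable, ?_⟩ (hX.hasLaw i)
    have hd : ∀ x, axialDensity p θ κ f x = axialDensity p (AxialUniformity.rotate L θ) κ f
        (AxialUniformity.rotate L x) := fun x => by
      simp [axialDensity, LinearIsometryEquiv.inner_map_map]
    ext t ht
    have hm : Measurable fun x => ENNReal.ofReal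
        (axialDensity p (AxialUniformity.rotate L θ) κ f x) := by
      unfold axialDensity; fun_prop
    rw [Measure.map_apply (continuous_rotate L).measurable ht, axialLaw, axialLaw,
      withDensity_apply _ ht, withDensity_apply _ ((continuous_rotate L).measurable ht)]
    simp_rw [hd]
    exact (measurePreserving_rotate_surfaceMeasure L).setLIntegral_comp_preimage ht hm
  indep := hX.indep.comp (fun _ => AxialUniformity.rotate L)
    fun _ => (continuous_rotate L).measurable

end Convergence

end AxialUniformity
-- The limit laws under uniformity and under local alternatives
theorem mainTheorem5 (p : ℕ) (hp : 2 ≤ p) (f : ℝ → ℝ) (hf : AxialUniformity.IsAngular f)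
    {Ω' : Type*} [MeasurableSpace Ω'] (P' : Measure Ω') [IsProbabilityMeasure P']
    (Z : Ω' → Matrix (Fin p) (Fin p) ℝ)
    (hZ : HasLaw (fun ω => AxialUniformity.vecE (Z ω))
      (multivariateGaussian 0 (AxialUniformity.VMatrix p)) P')
    {Ω : ℕ → Type*} [∀ n, MeasurableSpace (Ω n)] (P : ∀ n, Measure (Ω n))
    [∀ n, IsProbabilityMeasure (P n)]
    (X : ∀ n : ℕ, Fin n → Ω n → AxialUniformity.Sph p) :
    ((∀ n, AxialUniformity.IsRandomSample (X n) (AxialUniformity.uniformLaw p) (P n)) →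
      TendstoInDistribution
        (fun n ω => AxialUniformity.extremeStat (fun i => X n i ω)) atTop
        (fun ω => (AxialUniformity.maxEigenvalue (Z ω), AxialUniformity.minEigenvalue (Z ω)))
        P P') ∧
    (∀ (θ : AxialUniformity.Sph p) (t : ℕ → ℝ) (τ : ℝ), Tendsto t atTop (𝓝 τ) →
      (∀ n, AxialUniformity.IsRandomSample (X n)
        (AxialUniformity.axialLaw p θ (t n * (p : ℝ) / √(n : ℝ)) f) (P n)) →
      TendstoInDistribution
        (fun n ω => AxialUniformity.extremeStat (fun i => X n i ω)) atTop
        (fun ω =>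
          (AxialUniformity.maxEigenvalue
            (Z ω + (2 * τ / ((p : ℝ) + 2)) • AxialUniformity.WMatrix p τ),
          AxialUniformity.minEigenvalue
            (Z ω + (2 * τ / ((p : ℝ) + 2)) • AxialUniformity.WMatrix p τ)))
        P P') := by
  have hp0 : 0 < p := by omega
  refine ⟨fun hX => ?_, fun θ t τ ht hX => ?_⟩
  · have h := AxialUniformity.tendstoInDistribution_scoreSum hp0 hZ hX (B := 0)
      (fun s => by simp [AxialUniformity.integral_inner_score hp0]) (fun s => tendsto_const_nhds)
    have h0 : AxialUniformity.vecE (0 : Matrix (Fin p) (Fin p) ℝ) = 0 := by ext; simp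
    rw [← h0] at h
    simpa only [add_zero] using AxialUniformity.tendstoInDistribution_extremeStat hp0 hZ
      Matrix.isSymm_zero h (fun _ _ => rfl)
  · obtain ⟨e, he⟩ := AxialUniformity.exists_score_eq_vecE_WMatrix hp0 τ
    -- Rotating `θ` to `e` leaves the statistics unchanged and makes the drift a multiple of `W_τ`.
    obtain ⟨L, hL⟩ := AxialUniformity.exists_isometry_apply_eq
      (u := (θ : EuclideanSpace ℝ (Fin p))) (v := (e : EuclideanSpace ℝ (Fin p))) (by simp)
    have hLθ : AxialUniformity.rotate L θ = e := Subtype.ext hL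
    have hY := fun n => (hX n).rotate hf.measurable L
    rw [hLθ] at hY
    have hprob := AxialUniformity.IsRandomSample.eventually_isProbabilityMeasure hY
    have hκ : Tendsto (fun n : ℕ => √(n : ℝ) * (t n * (p : ℝ) / √(n : ℝ))) atTop
        (𝓝 (τ * p)) := by
      refine (ht.mul_const (p : ℝ)).congr' ?_
      filter_upwards [eventually_gt_atTop 0] with n hn
      have hs0 : √(n : ℝ) ≠ 0 := (Real.sqrt_pos.2 (by exact_mod_cast hn)).ne'
      field_simp
    have hcont : ∀ s, Continuous fun x : AxialUniformity.Sph p =>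
        (inner ℝ (AxialUniformity.score x) s : ℝ) :=
      fun s => AxialUniformity.continuous_score.inner continuous_const
    have h := AxialUniformity.tendstoInDistribution_scoreSum hp0 hZ hY
      (B := AxialUniformity.vecE ((2 * τ / ((p : ℝ) + 2)) • AxialUniformity.WMatrix p τ))
      (fun s => ?_) (fun s => ?_)
    · exact AxialUniformity.tendstoInDistribution_extremeStat hp0 hZ
        ((AxialUniformity.isSymm_WMatrix τ).smul _) h
        (fun n ω => AxialUniformity.quadExtremes_scoreSum_rotate L _)
    · have hB : AxialUniformity.vecE ((2 * τ / ((p : ℝ) + 2)) • AxialUniformity.WMatrix p τ) =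
          (2 * τ / ((p : ℝ) + 2)) • AxialUniformity.score e := by
        rw [he]; rfl
      have hlim := (AxialUniformity.tendsto_integral_axialLaw hp0 e hf hκ hprob (hcont s)).2
        (AxialUniformity.integral_inner_score hp0 s)
      rw [AxialUniformity.integral_inner_score_mul_sq hp0] at hlim
      rw [hB, real_inner_smul_left]
      -- The constants match because `τ p · 2/(p(p+2)) = 2τ/(p+2)`.
      convert hlim using 2
      have hpp : (p : ℝ) ≠ 0 := by positivity
      field_simp
    · exact (AxialUniformity.tendsto_integral_axialLaw hp0 e hf hκ hprob ((hcont s).pow 2)).1
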